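/- **Theorem 2.** Let $U\subseteq\mathbb R^4$ be open and let $e_0=u,e_1,e_2,e_3$ be smooth vector fields on $U$ that form a basis at each point. Let $g$ be the Lorentzian metric for which they are orthonormal, $g_{ab}=\mathrm{diag}(-1,1,1,1)$; let $[e_a,e_b]=\gamma^c{}_{ab}e_c$, let $\nabla$ be the Levi-Civita connection of $g$, with curvature $R^a{}_{bcd}$, Ricci tensor $R_{bd}=R^c{}_{bcd}$ and scalar curvature $R$. All indices refer to the tetrad, $a,b,\dots$ running over $0,\dots,3$ and $\alpha,\beta,\dots$ over $1,2,3$; $h_{ab}=g_{ab}+u_au_b$, $\eta_{abcd}$ is totally antisymmetric with $\eta_{0123}=-1$, and $\varepsilon_{abc}=\eta_{abcd}u^d$. Let $\rho,p$ be smooth functions, $q_a$ a smooth vector field orthogonal to $u$, and $\pi_{ab},E_{ab},H_{ab}$ smooth symmetric trace-free tensor fields orthogonal to $u$, on $U$. Put $$T_{ab}=\rho u_au_b+p h_{ab}+2q_{(a}u_{b)}+\pi_{ab},\qquad T=T^a{}_a,$$ $$C_{ab}{}^{cd}=4\bigl(u_{[a}u^{[c}+h_{[a}{}^{[c}\bigr)E_{b]}{}^{d]}+2\varepsilon_{abe}u^{[c}H^{d]e}+2\varepsilon^{cde}u_{[a}H_{b]e},$$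 $$K_{abcd}=C_{abcd}+\bigl(g_{a[c}S_{d]b}+g_{b[d}S_{c]a}\bigr)+\tfrac13 T\,g_{a[c}g_{d]b},\qquad S_{ab}=T_{ab}-\tfrac12Tg_{ab}.$$ The *Jacobi-Ricci-Bianchi (JRB) system* consists of the Jacobi equations $e_{[a}\gamma^d{}_{bc]}-\gamma^d{}_{e[a}\gamma^e{}_{bc]}=0$, the Ricci equations for $u$, $u^a{}_{;c;d}-u^a{}_{;d;c}=K^a{}_{0dc}$, and the second Bianchi equations $K^a{}_{b[cd;e]}=0$. Put $\mathcal I_{\alpha\beta}=E_{\alpha\beta}-\tfrac12\pi_{\alpha\beta}$, $\mathcal J_{\alpha\beta}=H_{\alpha\beta}-\tfrac12\eta_{\alpha\beta cd}q^cu^d$ and $\mathcal Y_{\alpha\beta}=T_{\alpha\beta}-(R_{\alpha\beta}-\tfrac12Rg_{\alpha\beta})$. Call a point $x\in U$ *generic* if at $x$ 1. $[\mathcal I,H]=0$; 2. $\mathcal I$ is non-degenerate, i.e. has three distinct eigenvalues; 3. $q$ is not parallel to an eigenblade of $H$, where an eigenblade of a matrix is an invariant line or plane through $0$ and only those eigenblades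 of $H$ matter that are also eigenblades of $\mathcal I$; in other words, $q_1q_2q_3\ne0$ in a common eigenframe of $\mathcal I$ and $H$. Then: (a) If the JRB system holds on $U$, then the Einstein field equations $R_{ab}-\tfrac12Rg_{ab}=T_{ab}$ hold (all ten of them) at every generic point. (b) If the JRB system holds on $U$, then at every point of $U$ the $\mathcal Y_{\alpha\beta}$ satisfy the homogeneous linear system (the integrability conditions of the second Bianchi equations) $$\begin{pmatrix}-\mathcal I_{23}&0&\mathcal I_{23}\\ \mathcal I_{31}&-\mathcal I_{31}&0\\ 0&\mathcal I_{12}&-\mathcal I_{12}\end{pmatrix}\begin{pmatrix}\mathcal Y_{33}\\ \mathcal Y_{11}\\ \mathcal Y_{22}\end{pmatrix}=\begin{pmatrix}-\mathcal I_{31}&\mathcal I_{22}-\mathcal I_{33}&\mathcal I_{12}\\ \mathcal I_{23}&-\mathcal I_{12}&\mathcal I_{33}-\mathcal I_{11}\\ \mathcal I_{11}-\mathcal I_{22}&\mathcal I_{31}&-\mathcal I_{23}\end{pmatrix}\begin{pmatrix}\mathcal Y_{12}\\ \mathcal Y_{23}\\ \mathcal Y_{31}\end{pmatrix},$$ $$\begin{pmatrix}0&-\mathcal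 J_{21}&\mathcal J_{12}\\ -\mathcal J_{13}&\mathcal J_{31}&0\\ \mathcal J_{23}&0&-\mathcal J_{32}\end{pmatrix}\begin{pmatrix}\mathcal Y_{33}\\ \mathcal Y_{11}\\ \mathcal Y_{22}\end{pmatrix}=\begin{pmatrix}\mathcal J_{22}-\mathcal J_{11}&-\mathcal J_{13}&\mathcal J_{23}\\ -\mathcal J_{32}&\mathcal J_{12}&\mathcal J_{11}-\mathcal J_{33}\\ \mathcal J_{31}&\mathcal J_{33}-\mathcal J_{22}&-\mathcal J_{21}\end{pmatrix}\begin{pmatrix}\mathcal Y_{12}\\ \mathcal Y_{23}\\ \mathcal Y_{31}\end{pmatrix}.$$ (c) At every generic point at which the Jacobi and Ricci equations hold, this linear system is equivalent to the Einstein field equations. -/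

import Mathlib

open scoped ContDiff Matrix

noncomputable section

namespace JRB

/-- Points of a coordinate patch of space-time. -/
abbrev Pt : Type := Fin 4 → ℝ

/-- Tetrad components `g_ab = diag(-1, 1, 1, 1)` of the metric in an orthonormal tetrad.
They coincide with the components of the inverse metric. -/
def g (a b : Fin 4) : ℝ := (Matrix.diagonal ![-1, 1, 1, 1] : Matrix (Fin 4) (Fin 4) ℝ) a b

/-- Contravariant components `u^a` of the timelike unit vector `u = e_0`. -/
def uUp (a : Fin 4) : ℝ := if a = 0 then 1 else 0

/-- Covariant components `u_a`. -/
def uLow (a : Fin 4) : ℝ := ∑ b, g a b * uUp b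

/-- The projector `h_ab = g_ab + u_a u_b`. -/
def h (a b : Fin 4) : ℝ := g a b + uLow a * uLow b

/-- The Levi-Civita tensor `η_abcd` in the tetrad, normalised by `η_0123 = -1`. -/
def eta (a b c d : Fin 4) : ℝ :=
  -((Matrix.of fun i j : Fin 4 => if ![a, b, c, d] i = j then (1 : ℤ) else 0).det : ℝ)

/-- `ε_abc = η_abcd u^d`. -/
def eps (a b c : Fin 4) : ℝ := ∑ d, eta a b c d * uUp d

/-- A spatial vector regarded as a four-vector orthogonal to `u`. -/
def extVec (v : Fin 3 → ℝ) (a : Fin 4) : ℝ := Fin.cases 0 v a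

/-- A spatial 2-tensor regarded as a space-time tensor orthogonal to `u`. -/
def extMat (M : Matrix (Fin 3) (Fin 3) ℝ) (a b : Fin 4) : ℝ :=
  Fin.cases 0 (fun α => Fin.cases 0 (fun β => M α β) b) a

/-- The unknowns: an orthonormal tetrad `e_a` (with `e_0 = u`), its commutation coefficients
`γ^c_ab` (written `γ c a b`), and the spatial tensors and scalars out of which the energy-momentum
tensor and the Weyl part of the curvature are built. The index `α : Fin 3` is the spatial tetrad
index `α + 1`. -/
structure Fields where
  e : Fin 4 → Pt → Pt
  γ : Fin 4 → Fin 4 → Fin 4 → Pt → ℝ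
  /-- electric Weyl part -/
  E : Pt → Matrix (Fin 3) (Fin 3) ℝ
  /-- magnetic Weyl part -/
  H : Pt → Matrix (Fin 3) (Fin 3) ℝ
  /-- anisotropic pressure -/
  aniso : Pt → Matrix (Fin 3) (Fin 3) ℝ
  /-- energy flux -/
  q : Pt → Fin 3 → ℝ
  /-- energy density -/
  ρ : Pt → ℝ
  /-- isotropic pressure -/
  p : Pt → ℝ

namespace Fields

variable (S : Fields)

/-- On `U` all fields are smooth, the `e_a` form a basis at each point and satisfy
`[e_a, e_b] = γ^c_ab e_c`, and `E`, `H`, `aniso` are symmetric and trace-free. -/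
structure IsRegularOn (U : Set Pt) : Prop where
  smooth_e : ∀ a, ContDiffOn ℝ ∞ (S.e a) U
  linInd : ∀ x ∈ U, LinearIndependent ℝ (fun a => S.e a x)
  commutators : ∀ x ∈ U, ∀ a b,
    VectorField.lieBracket ℝ (S.e a) (S.e b) x = ∑ c, S.γ c a b x • S.e c x
  smooth_γ : ∀ c a b, ContDiffOn ℝ ∞ (S.γ c a b) U
  smooth_E : ∀ α β, ContDiffOn ℝ ∞ (fun x => S.E x α β) U
  smooth_H : ∀ α β, ContDiffOn ℝ ∞ (fun x => S.H x α β) U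
  smooth_aniso : ∀ α β, ContDiffOn ℝ ∞ (fun x => S.aniso x α β) U
  smooth_q : ∀ α, ContDiffOn ℝ ∞ (fun x => S.q x α) U
  smooth_ρ : ContDiffOn ℝ ∞ S.ρ U
  smooth_p : ContDiffOn ℝ ∞ S.p U
  symm_E : ∀ x ∈ U, (S.E x).IsSymm
  symm_H : ∀ x ∈ U, (S.H x).IsSymm
  symm_aniso : ∀ x ∈ U, (S.aniso x).IsSymm
  trace_E : ∀ x ∈ U, (S.E x).trace = 0
  trace_H : ∀ x ∈ U, (S.H x).trace = 0
  trace_aniso : ∀ x ∈ U, (S.aniso x).trace = 0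

/-- Directional derivative `∂_a f` along `e_a`. -/
def dd (a : Fin 4) (f : Pt → ℝ) (x : Pt) : ℝ := fderiv ℝ f x (S.e a x)

/-! ### The Levi-Civita connection of the tetrad and its curvature -/

/-- `γ_cab = g_cd γ^d_ab`. -/
def γLow (c a b : Fin 4) (x : Pt) : ℝ := ∑ d, g c d * S.γ d a b x

/-- `Γ_cab = ½ (γ_bca + γ_acb - γ_cab)`. -/
def ΓLow (c a b : Fin 4) (x : Pt) : ℝ :=
  (1 / 2) * (S.γLow b c a x + S.γLow a c b x - S.γLow c a b x)

/-- `Γ^c_ab`, where `∇_{e_b} e_a = Γ^c_ab e_c`. -/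
def Γ (c a b : Fin 4) (x : Pt) : ℝ := ∑ d, g c d * S.ΓLow d a b x

/-- The curvature `R^a_bcd` of the Levi-Civita connection. -/
def riemann (a b c d : Fin 4) (x : Pt) : ℝ :=
  S.dd c (S.Γ a b d) x - S.dd d (S.Γ a b c) x
    + ∑ f, (S.Γ f b d x * S.Γ a f c x - S.Γ f b c x * S.Γ a f d x - S.γ f c d x * S.Γ a b f x)

/-- The Ricci tensor `R_bd = R^c_bcd`. -/
def ricci (b d : Fin 4) (x : Pt) : ℝ := ∑ c, S.riemann c b c d x

/-- The scalar curvature. -/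
def scalar (x : Pt) : ℝ := ∑ a, ∑ b, g a b * S.ricci a b x

/-- The Einstein tensor `R_ab - ½ R g_ab`. -/
def einstein (a b : Fin 4) (x : Pt) : ℝ := S.ricci a b x - (1 / 2) * S.scalar x * g a b

/-! ### Energy-momentum tensor and the curvature built from the field variables -/

/-- `T_ab = ρ u_a u_b + p h_ab + 2 q_(a u_b) + π_ab`. -/
def T (a b : Fin 4) (x : Pt) : ℝ :=
  S.ρ x * uLow a * uLow b + S.p x * h a b
    + (extVec (S.q x) a * uLow b + extVec (S.q x) b * uLow a) + extMat (S.aniso x) a b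

/-- The trace of the energy-momentum tensor. -/
def trT (x : Pt) : ℝ := ∑ a, ∑ b, g a b * S.T a b x

/-- The Weyl-type tensor with electric part `E` and magnetic part `H`:
`4 (u_[a u_[c + h_[a[c) E_b]d] + 2 ε_abe u_[c H_d]^e + 2 ε_cde u_[a H_b]^e`. -/
def weyl (a b c d : Fin 4) (x : Pt) : ℝ :=
  ((uLow a * uLow c + h a c) * extMat (S.E x) b d
      - (uLow b * uLow c + h b c) * extMat (S.E x) a d
      - (uLow a * uLow d + h a d) * extMat (S.E x) b c
      + (uLow b * uLow d + h b d) * extMat (S.E x) a c)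
    + ∑ f, eps a b f * (uLow c * extMat (S.H x) d f - uLow d * extMat (S.H x) c f)
    + ∑ f, eps c d f * (uLow a * extMat (S.H x) b f - uLow b * extMat (S.H x) a f)

/-- The Ricci-type tensor `T_ab - ½ T g_ab`. -/
def ric (a b : Fin 4) (x : Pt) : ℝ := S.T a b x - (1 / 2) * S.trT x * g a b

/-- The curvature variable `K_abcd`, i.e. the Riemann tensor as expressed through
`E, H, q, π, ρ, p`:
`C_abcd + g_a[c R_d]b + g_b[d R_c]a - ⅓ R g_a[c g_d]b` with `R_ab = T_ab - ½ T g_ab`,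
`R = -T`. -/
def K (a b c d : Fin 4) (x : Pt) : ℝ :=
  S.weyl a b c d x
    + (1 / 2) * (g a c * S.ric d b x - g a d * S.ric c b x)
    + (1 / 2) * (g b d * S.ric c a x - g b c * S.ric d a x)
    - (1 / 3) * (-S.trT x) * ((1 / 2) * (g a c * g d b - g a d * g c b))

/-- `K^a_bcd`. -/
def KUp (a b c d : Fin 4) (x : Pt) : ℝ := ∑ f, g a f * S.K f b c d x

/-! ### Covariant derivatives in the tetrad -/

/-- `w^a_;c`. -/
def covVec (w : Fin 4 → Pt → ℝ) (a c : Fin 4) (x : Pt) : ℝ :=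
  S.dd c (w a) x + ∑ f, S.Γ a f c x * w f x

/-- `w^a_;c;d`. -/
def covVec2 (w : Fin 4 → Pt → ℝ) (a c d : Fin 4) (x : Pt) : ℝ :=
  S.dd d (S.covVec w a c) x
    + ∑ f, (S.Γ a f d x * S.covVec w f c x - S.Γ f c d x * S.covVec w a f x)

/-- `K^a_bcd;e` -/
def covK (a b c d e : Fin 4) (x : Pt) : ℝ :=
  S.dd e (S.KUp a b c d) x
    + ∑ f, (S.Γ a f e x * S.KUp f b c d x - S.Γ f b e x * S.KUp a f c d x
        - S.Γ f c e x * S.KUp a b f d x - S.Γ f d e x * S.KUp a b c f x)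

/-! ### The Jacobi-Ricci-Bianchi system and the field equations -/

/-- Jacobi equations `∂_[a γ^d_bc] - γ^d_f[a γ^f_bc] = 0`
(`γ^d_bc` being antisymmetric in `bc`). -/
def Jacobi (x : Pt) : Prop :=
  ∀ a b c d : Fin 4,
    (S.dd a (S.γ d b c) x + S.dd b (S.γ d c a) x + S.dd c (S.γ d a b) x)
      - ∑ f, (S.γ d f a x * S.γ f b c x + S.γ d f b x * S.γ f c a x
          + S.γ d f c x * S.γ f a b x) = 0

/-- Ricci equations for `u`: `u^a_;c;d - u^a_;d;c = K^a_0dc`. -/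
def RicciU (x : Pt) : Prop :=
  ∀ a c d : Fin 4,
    S.covVec2 (fun b _ => uUp b) a c d x - S.covVec2 (fun b _ => uUp b) a d c x
      = S.KUp a 0 d c x

/-- Second Bianchi equations `K^a_b[cd;e] = 0` (`K^a_bcd` being antisymmetric in `cd`). -/
def Bianchi (x : Pt) : Prop :=
  ∀ a b c d e : Fin 4, S.covK a b c d e x + S.covK a b d e c x + S.covK a b e c d x = 0

/-- The Jacobi-Ricci-Bianchi system on `U`. -/
def IsJRBSolutionOn (U : Set Pt) : Prop :=
  ∀ x ∈ U, S.Jacobi x ∧ S.RicciU x ∧ S.Bianchi x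

/-- The Einstein field equations `R_ab - ½ R g_ab = T_ab` at `x`. -/
def EFE (x : Pt) : Prop := ∀ a b : Fin 4, S.einstein a b x = S.T a b x

/-- `𝓘_αβ = E_αβ - ½ π_αβ`. -/
def I (x : Pt) : Matrix (Fin 3) (Fin 3) ℝ := S.E x - (1 / 2 : ℝ) • S.aniso x

/-- `𝓙_αβ = H_αβ - ½ η_αβcd q^c u^d`. -/
def J (x : Pt) : Matrix (Fin 3) (Fin 3) ℝ := Matrix.of fun α β =>
  S.H x α β - (1 / 2) * ∑ c, ∑ d, eta α.succ β.succ c d * extVec (S.q x) c * uUp d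

/-- The deviation `𝓨_αβ` from the spatial field equations, `T_αβ - (R_αβ - ½ R g_αβ)`. -/
def Y (x : Pt) : Matrix (Fin 3) (Fin 3) ℝ := Matrix.of fun α β =>
  S.T α.succ β.succ x - S.einstein α.succ β.succ x

/-- The homogeneous linear system for the `𝓨_αβ`. -/
def YSystem (x : Pt) : Prop :=
  let I := S.I x
  let J := S.J x
  let Y := S.Y x
  !![-I 1 2, 0, I 1 2;
     I 2 0, -I 2 0, 0;
     0, I 0 1, -I 0 1] *ᵥ ![Y 2 2, Y 0 0, Y 1 1]
    = !![-I 2 0, I 1 1 - I 2 2, I 0 1;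
         I 1 2, -I 0 1, I 2 2 - I 0 0;
         I 0 0 - I 1 1, I 2 0, -I 1 2] *ᵥ ![Y 0 1, Y 1 2, Y 2 0] ∧
  !![0, -J 1 0, J 0 1;
     -J 0 2, J 2 0, 0;
     J 1 2, 0, -J 2 1] *ᵥ ![Y 2 2, Y 0 0, Y 1 1]
    = !![J 1 1 - J 0 0, -J 0 2, J 1 2;
         -J 2 1, J 0 1, J 0 0 - J 2 2;
         J 2 0, J 2 2 - J 1 1, -J 1 0] *ᵥ ![Y 0 1, Y 1 2, Y 2 0]

end Fields

/-- Non-degeneracy in the sense of distinct eigenvalues: every eigenspace is at most a line. -/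
def NonDegenerate (M : Matrix (Fin 3) (Fin 3) ℝ) : Prop :=
  ∀ μ : ℝ, Module.finrank ℝ (Module.End.eigenspace (Matrix.toLin' M) μ) ≤ 1

/-- An eigenblade of `M`, given by the subspace it spans: a line or a plane mapped into itself. -/
def IsEigenblade (M : Matrix (Fin 3) (Fin 3) ℝ) (P : Submodule ℝ (Fin 3 → ℝ)) : Prop :=
  P ≠ ⊥ ∧ P ≠ ⊤ ∧ ∀ v ∈ P, M *ᵥ v ∈ P

/-- The genericity conditions at `x`: `𝓘` and `H` commute, `𝓘` is non-degenerate, and `q` is not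
parallel to an eigenblade of `H`. Only the eigenblades of `H` that are adapted to a common
eigenframe of `𝓘` and `H`, i.e. that are eigenblades of `𝓘` too, have to be avoided
(all of them when `H` has distinct eigenvalues). -/
structure Generic (S : Fields) (x : Pt) : Prop where
  commute : Commute (S.I x) (S.H x)
  nonDegenerate : NonDegenerate (S.I x)
  not_parallel : ∀ P, IsEigenblade (S.H x) P → IsEigenblade (S.I x) P → S.q x ∉ P

end JRB

end

/-! Let `Ω` be the curvature form of `∇` and `K` the curvature variable, both as matrix-valued
2-forms, and let `D` be the exterior covariant derivative. The second Bianchi equations say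
`D K = 0`, so `0 = D² K = Ω ∧ K - K ∧ Ω`; since a 2-form wedge-commutes with itself, the
deviation `Δ = K - Ω` satisfies `Δ ∧ K = K ∧ Δ`. The Jacobi equations are the first Bianchi
identity of `∇`, so `Δ` has the symmetries of a curvature tensor, and the Ricci equations for `u`
annihilate its components with an index `0`. Hence `Δ` takes values in the rotations and is dual
to its Einstein contraction, which is `𝓨`. Splitting the Lorentz algebra into boosts and
rotations turns `Δ ∧ K = K ∧ Δ` into the symmetry of `𝓘𝓨` and `𝓙𝓨`, which is the linear system.

At a generic point `𝓨` and `H` commute with the non-degenerate `𝓘`, hence with each other. As `𝓙`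
is `H` plus half the cross product matrix `[q]` of `q`, the symmetry of `𝓙𝓨` reduces to
`𝓨[q] + [q]𝓨 = 0`, i.e. `(tr 𝓨 - 𝓨) q = 0`. The kernel of `tr 𝓨 - 𝓨` is invariant under `𝓘` and
`H` and contains `q`, so it is the whole space, and `𝓨 = 0`. -/

noncomputable section

namespace JRB

section CrossProduct

theorem isSymm_fin_three_iff {R : Type*} {M : Matrix (Fin 3) (Fin 3) R} :
    M.IsSymm ↔ M 1 2 = M 2 1 ∧ M 2 0 = M 0 2 ∧ M 0 1 = M 1 0 := by
  refine ⟨fun hM => ⟨hM.apply _ _, hM.apply _ _, hM.apply _ _⟩, fun ⟨h₁₂, h₂₀, h₀₁⟩ => ?_⟩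
  ext i j
  fin_cases i <;> fin_cases j <;> simp [h₁₂, h₂₀, h₀₁]

variable {R : Type*} [CommRing R]

/-- The matrix of the map `w ↦ v ⨯₃ w`. -/
def crossMatrix (v : Fin 3 → R) : Matrix (Fin 3) (Fin 3) R :=
  !![0, -v 2, v 1; v 2, 0, -v 0; -v 1, v 0, 0]

theorem crossMatrix_zero : crossMatrix (0 : Fin 3 → R) = 0 := by
  ext i j
  fin_cases i <;> fin_cases j <;> simp [crossMatrix]

theorem transpose_crossMatrix (v : Fin 3 → R) : (crossMatrix v)ᵀ = -crossMatrix v := by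
  ext i j
  fin_cases i <;> fin_cases j <;> simp [crossMatrix]

theorem crossMatrix_injective : Function.Injective (crossMatrix (R := R)) := fun v w hvw => by
  have entry (i j : Fin 3) := congrFun₂ hvw i j
  ext i
  fin_cases i
  · exact entry 2 1
  · exact entry 0 2
  · exact entry 1 0

theorem transpose_mul_crossMatrix_add (M : Matrix (Fin 3) (Fin 3) R) (v : Fin 3 → R) :
    Mᵀ * crossMatrix v + crossMatrix v * M = crossMatrix (M.trace • v - M *ᵥ v) := by
  ext i j
  simp only [Matrix.add_apply, Matrix.mul_apply, Fin.sum_univ_three]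
  fin_cases i <;> fin_cases j <;>
    simp [crossMatrix, Matrix.mulVec, dotProduct, Matrix.trace, Fin.sum_univ_three] <;> ring

theorem sum_cross_eq_zero_iff {A B : Matrix (Fin 3) (Fin 3) R} :
    ∑ k, (A k) ⨯₃ (B k) = 0 ↔ (Aᵀ * B).IsSymm := by
  rw [isSymm_fin_three_iff, funext_iff, Fin.forall_fin_succ, Fin.forall_fin_two]
  simp only [Finset.sum_apply, cross_apply, Matrix.mul_apply, Matrix.transpose_apply]
  simp [Finset.sum_sub_distrib, sub_eq_zero, mul_comm]

/-- The matrix of an infinitesimal Lorentz transformation with boost part `b` and rotation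
part `r`. -/
def lorentzGen : (Fin 3 → R) × (Fin 3 → R) →ₗ[R] Matrix (Fin 4) (Fin 4) R where
  toFun v := !![0, v.1 0, v.1 1, v.1 2; v.1 0, 0, -v.2 2, v.2 1;
    v.1 1, v.2 2, 0, -v.2 0; v.1 2, -v.2 1, v.2 0, 0]
  map_add' v w := by
    ext i j
    fin_cases i <;> fin_cases j <;> simp <;> ring
  map_smul' c v := by
    ext i j
    fin_cases i <;> fin_cases j <;> simp

theorem lorentzGen_injective : Function.Injective (lorentzGen (R := R)) := fun v w hvw => by
  have entry (i j : Fin 4) := congrFun₂ hvw i j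
  ext i <;> fin_cases i
  · exact entry 0 1
  · exact entry 0 2
  · exact entry 0 3
  · exact entry 3 2
  · exact entry 1 3
  · exact entry 2 1

theorem lie_lorentzGen (b r c s : Fin 3 → R) :
    ⁅lorentzGen (b, r), lorentzGen (c, s)⁆ =
      lorentzGen (b ⨯₃ s + r ⨯₃ c, r ⨯₃ s - b ⨯₃ c) := by
  ext i j
  fin_cases i <;> fin_cases j <;>
    simp [lorentzGen, Ring.lie_def, cross_apply] <;> ring

end CrossProduct

section CommonEigenblades

theorem commute_of_finrank_eigenspace_le_one {K V : Type*} [Field K] [AddCommGroup V] [Module K V]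
    [FiniteDimensional K V] {f₁ f₂ f₃ : Module.End K V} (hf : ⨆ μ, f₁.eigenspace μ = ⊤)
    (hrank : ∀ μ, Module.finrank K (f₁.eigenspace μ) ≤ 1) (h₁₂ : Commute f₁ f₂)
    (h₁₃ : Commute f₁ f₃) : Commute f₂ f₃ := by
  have scalar {f : Module.End K V} (hf : Commute f₁ f) (μ : K) {w : f₁.eigenspace μ}
      (hw : ∀ v, ∃ c : K, c • w = v) : ∃ c : K, c • (w : V) = f w :=
    (hw ⟨f w, f₁.mapsTo_genEigenspace_of_comm hf μ 1 w.2⟩).imp fun _ hc =>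
      congrArg Subtype.val hc
  have hle (μ : K) : f₁.eigenspace μ ≤ LinearMap.eqLocus (f₂ * f₃) (f₃ * f₂) := by
    intro v hv
    obtain ⟨w, hw⟩ := finrank_le_one_iff.mp (hrank μ)
    obtain ⟨a, ha⟩ := scalar h₁₂ μ hw
    obtain ⟨b, hb⟩ := scalar h₁₃ μ hw
    obtain ⟨c, hc⟩ := hw ⟨v, hv⟩
    obtain rfl : c • (w : V) = v := congrArg Subtype.val hc
    simp [← ha, ← hb, smul_comm a b]
  exact LinearMap.ext fun v => iSup_le hle (hf ▸ Submodule.mem_top)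

theorem iSup_eigenspace_toLin'_eq_top {𝕜 n : Type*} [RCLike 𝕜] [Fintype n] [DecidableEq n]
    {A : Matrix n n 𝕜} (hA : A.IsHermitian) :
    ⨆ μ, Module.End.eigenspace (Matrix.toLin' A) μ = ⊤ := by
  refine (Submodule.eq_top_iff_forall_basis_mem
    (hA.eigenvectorBasis.toBasis.map (WithLp.linearEquiv 2 𝕜 (n → 𝕜)))).mpr fun j =>
      Submodule.mem_iSup_of_mem (hA.eigenvalues j : 𝕜) ?_
  rw [Module.End.mem_eigenspace_iff]
  simpa [← RCLike.real_smul_eq_coe_smul (K := 𝕜)] using hA.mulVec_eigenvectorBasis j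

variable {A B H : Matrix (Fin 3) (Fin 3) ℝ} {q : Fin 3 → ℝ}

theorem iSup_eigenspace_toLin'_eq_top_of_isSymm (hA : A.IsSymm) :
    ⨆ μ, Module.End.eigenspace (Matrix.toLin' A) μ = ⊤ :=
  iSup_eigenspace_toLin'_eq_top ((Matrix.conjTranspose_eq_transpose_of_trivial A).trans hA)

theorem commute_toLin' (hAB : Commute A B) : Commute (Matrix.toLin' A) (Matrix.toLin' B) :=
  hAB.map Matrix.toLinAlgEquiv'

theorem NonDegenerate.commute (hA : NonDegenerate A) (hAs : A.IsSymm) (hAB : Commute A B)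
    (hAH : Commute A H) : Commute B H := by
  have hBH := commute_of_finrank_eigenspace_le_one (iSup_eigenspace_toLin'_eq_top_of_isSymm hAs) hA
    (commute_toLin' hAB) (commute_toLin' hAH)
  exact (commute_map_iff Matrix.toLinAlgEquiv'.injective).mp hBH

theorem NonDegenerate.exists_isEigenblade (hA : NonDegenerate A) (hAs : A.IsSymm) :
    ∃ P, ∀ B, Commute A B → IsEigenblade B P := by
  obtain ⟨μ, hμ⟩ : ∃ μ, Module.End.eigenspace (Matrix.toLin' A) μ ≠ ⊥ := by
    by_contra! hbot
    have htop := iSup_eigenspace_toLin'_eq_top_of_isSymm hAs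
    simp [hbot] at htop
  refine ⟨_, fun B hAB => ⟨hμ, fun htop => ?_, fun v hv => ?_⟩⟩
  · have hrank := hA μ
    rw [htop] at hrank
    simp at hrank
  · exact Module.End.mapsTo_genEigenspace_of_comm (commute_toLin' hAB) μ 1 hv

theorem eq_zero_of_mulVec_eq_zero (hBA : Commute B A) (hBH : Commute B H) (hq₀ : q ≠ 0)
    (hq : ∀ P, IsEigenblade H P → IsEigenblade A P → q ∉ P) (hBq : B *ᵥ q = 0) : B = 0 := by
  let P := LinearMap.ker (Matrix.toLin' B)
  have hqP : q ∈ P := hBq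
  have hbot : P ≠ ⊥ := fun hP => hq₀ (by rwa [hP, Submodule.mem_bot] at hqP)
  have hinv {M : Matrix (Fin 3) (Fin 3) ℝ} (hBM : Commute B M) (v : Fin 3 → ℝ) (hv : v ∈ P) :
      M *ᵥ v ∈ P := by
    rw [LinearMap.mem_ker, Matrix.toLin'_apply] at hv ⊢
    rw [Matrix.mulVec_mulVec, hBM.eq, ← Matrix.mulVec_mulVec, hv, Matrix.mulVec_zero]
  have htop : P = ⊤ := by
    by_contra htop
    exact hq P ⟨hbot, htop, hinv hBH⟩ ⟨hbot, htop, hinv hBA⟩ hqP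
  exact (Matrix.toLin').map_eq_zero_iff.mp (LinearMap.ker_eq_top.mp htop)

theorem eq_zero_of_trace_smul_one_sub_eq_zero (hB : B.trace • 1 - B = 0) : B = 0 := by
  have htrace : B.trace * 3 - B.trace = 0 := by simpa using congrArg Matrix.trace hB
  rw [show B.trace = 0 by linarith, zero_smul, zero_sub, neg_eq_zero] at hB
  exact hB

theorem NonDegenerate.eq_zero_of_trace_smul_sub_mulVec (hA : NonDegenerate A) (hAs : A.IsSymm)
    (hAH : Commute A H) (hAB : Commute A B)
    (hq : ∀ P, IsEigenblade H P → IsEigenblade A P → q ∉ P) (hBq : B.trace • q - B *ᵥ q = 0) :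
    B = 0 := by
  obtain ⟨P, hP⟩ := hA.exists_isEigenblade hAs
  have hq₀ : q ≠ 0 := by
    rintro rfl
    exact hq P (hP H hAH) (hP A (.refl A)) P.zero_mem
  have hcomm {M : Matrix (Fin 3) (Fin 3) ℝ} (hBM : Commute B M) :
      Commute (B.trace • 1 - B) M :=
    ((Commute.one_left M).smul_left _).sub_left hBM
  refine eq_zero_of_trace_smul_one_sub_eq_zero (eq_zero_of_mulVec_eq_zero (hcomm hAB.symm)
    (hcomm (hA.commute hAs hAB hAH)) hq₀ hq ?_)
  simpa [Matrix.sub_mulVec, Matrix.smul_mulVec] using hBq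

end CommonEigenblades

theorem g_of_ne {a b : Fin 4} (hab : a ≠ b) : g a b = 0 := by
  rw [g, Matrix.diagonal_apply_ne _ hab]

theorem g_mul_self (a : Fin 4) : g a a * g a a = 1 := by
  fin_cases a <;> simp [g]

theorem g_comm (a b : Fin 4) : g a b = g b a :=
  (Matrix.isSymm_diagonal _).apply b a

theorem sum_g_mul (a : Fin 4) (f : Fin 4 → ℝ) : ∑ b, g a b * f b = g a a * f a :=
  Finset.sum_eq_single a (fun _ _ hb => by rw [g_of_ne hb.symm, zero_mul]) (by simp)

section CurvatureLike

variable {ι : Type*} {R R' : ι → ι → ι → ι → ℝ}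

/-- The symmetries under index permutations of a covariant curvature tensor, except for the
first Bianchi identity. -/
structure IsCurvatureLike (R : ι → ι → ι → ι → ℝ) : Prop where
  antisymm_left : ∀ a b c d, R a b c d = -R b a c d
  antisymm_right : ∀ a b c d, R a b c d = -R a b d c
  pair_symm : ∀ a b c d, R a b c d = R c d a b

theorem IsCurvatureLike.sub (hR : IsCurvatureLike R) (hR' : IsCurvatureLike R') :
    IsCurvatureLike fun a b c d => R a b c d - R' a b c d where
  antisymm_left a b c d := by rw [hR.antisymm_left, hR'.antisymm_left]; ring
  antisymm_right a b c d := by rw [hR.antisymm_right, hR'.antisymm_right]; ring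
  pair_symm a b c d := by rw [hR.pair_symm, hR'.pair_symm]

theorem IsCurvatureLike.of_cyclic (hleft : ∀ a b c d, R a b c d = -R b a c d)
    (hright : ∀ a b c d, R a b c d = -R a b d c)
    (hcyclic : ∀ a b c d, R a b c d + R a c d b + R a d b c = 0) : IsCurvatureLike R where
  antisymm_left := hleft
  antisymm_right := hright
  pair_symm a b c d := by
    linarith [hcyclic a b c d, hcyclic b c d a, hcyclic c d a b, hcyclic d a b c,
      hleft a b c d, hleft a c d b, hleft a d b c, hleft b c d a, hleft b d a c, hleft c d a b,
      hright a b c d, hright a c d b, hright a d b c, hright b c d a, hright b d a c,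
      hright c d a b, hright b a c d, hright c a d b, hright d a b c, hright c b d a,
      hright d b a c, hright d c a b]

end CurvatureLike

section Components

theorem g_eq (a b : Fin 4) : g a b =
    (!![-1, 0, 0, 0; 0, 1, 0, 0; 0, 0, 1, 0; 0, 0, 0, 1] : Matrix (Fin 4) (Fin 4) ℝ) a b := by
  fin_cases a <;> fin_cases b <;> simp [g]

theorem uLow_eq (a : Fin 4) : uLow a = (![-1, 0, 0, 0] : Fin 4 → ℝ) a := by
  fin_cases a <;> simp [uLow, uUp, g]

theorem h_eq (a b : Fin 4) : h a b =
    (!![0, 0, 0, 0; 0, 1, 0, 0; 0, 0, 1, 0; 0, 0, 0, 1] : Matrix (Fin 4) (Fin 4) ℝ) a b := by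
  fin_cases a <;> fin_cases b <;> simp [h, g, uLow_eq]

theorem h_comm (a b : Fin 4) : h a b = h b a := by
  rw [h, h, g_comm a b, mul_comm]

theorem extVec_eq (v : Fin 3 → ℝ) (a : Fin 4) : extVec v a = ![0, v 0, v 1, v 2] a := by
  fin_cases a <;> rfl

theorem extMat_eq (M : Matrix (Fin 3) (Fin 3) ℝ) (a b : Fin 4) : extMat M a b =
    !![0, 0, 0, 0; 0, M 0 0, M 0 1, M 0 2; 0, M 1 0, M 1 1, M 1 2; 0, M 2 0, M 2 1, M 2 2] a b := by
  fin_cases a <;> fin_cases b <;> rfl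

theorem extMat_symm {M : Matrix (Fin 3) (Fin 3) ℝ} (hM : M.IsSymm) (a b : Fin 4) :
    extMat M a b = extMat M b a := by
  induction a using Fin.cases <;> induction b using Fin.cases
  · rfl
  · rfl
  · rfl
  · exact hM.apply _ _

-- The Vandermonde product of `0, a, b, c` is alternating and equals `12` at `(1, 2, 3)`.
theorem eta_zero_right (a b c : Fin 4) : eta a b c 0 =
    (a : ℕ) * (b : ℕ) * (c : ℕ) * ((b : ℕ) - (a : ℕ)) * ((c : ℕ) - (a : ℕ))
      * ((c : ℕ) - (b : ℕ)) / 12 := by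
  have hdet : ∀ a b c : Fin 4,
      -(Matrix.of fun i j : Fin 4 => if ![a, b, c, 0] i = j then (1 : ℤ) else 0).det * 12 =
        (a : ℕ) * (b : ℕ) * (c : ℕ) * ((b : ℕ) - (a : ℕ)) * ((c : ℕ) - (a : ℕ))
          * ((c : ℕ) - (b : ℕ)) := by
    intro a b c
    rw [Matrix.det_succ_row _ 3, Fin.sum_univ_four]
    simp only [Matrix.det_fin_three, Matrix.submatrix_apply, Matrix.of_apply]
    revert a b c
    set_option maxRecDepth 100000 in
    decide
  have hcast := congrArg (Int.cast : ℤ → ℝ) (hdet a b c)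
  push_cast at hcast
  rw [eta, ← hcast]
  push_cast
  ring

theorem eps_eq (a b c : Fin 4) : eps a b c =
    (a : ℕ) * (b : ℕ) * (c : ℕ) * ((b : ℕ) - (a : ℕ)) * ((c : ℕ) - (a : ℕ))
      * ((c : ℕ) - (b : ℕ)) / 12 := by
  rw [← eta_zero_right]
  simp [eps, uUp]

theorem eps_antisymm (a b c : Fin 4) : eps a b c = -eps b a c := by
  rw [eps_eq, eps_eq]
  ring

end Components

section EinsteinContraction

variable (R : Fin 4 → Fin 4 → Fin 4 → Fin 4 → ℝ)

/-- The Ricci contraction `g^ac R_abcd` of a covariant tensor of curvature type. -/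
def ricciContraction (b d : Fin 4) : ℝ := ∑ a, g a a * R a b a d

/-- The Einstein tensor formed from `R` like that of the Riemann tensor. -/
def einsteinContraction (a b : Fin 4) : ℝ :=
  ricciContraction R a b - (1 / 2) * (∑ c, g c c * ricciContraction R c c) * g a b

variable {R}

theorem ricciContraction_sub (R R' : Fin 4 → Fin 4 → Fin 4 → Fin 4 → ℝ) (b d : Fin 4) :
    ricciContraction (fun a b c d => R a b c d - R' a b c d) b d =
      ricciContraction R b d - ricciContraction R' b d := by
  simp only [ricciContraction, mul_sub, Finset.sum_sub_distrib]

theorem einsteinContraction_sub (R R' : Fin 4 → Fin 4 → Fin 4 → Fin 4 → ℝ) (a b : Fin 4) :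
    einsteinContraction (fun a b c d => R a b c d - R' a b c d) a b =
      einsteinContraction R a b - einsteinContraction R' a b := by
  simp only [einsteinContraction, ricciContraction_sub, mul_sub, Finset.sum_sub_distrib]
  ring

theorem IsCurvatureLike.eq_zero_left (hR : IsCurvatureLike R) (a c d : Fin 4) : R a a c d = 0 :=
  self_eq_neg.mp (hR.antisymm_left a a c d)

theorem IsCurvatureLike.eq_zero_right (hR : IsCurvatureLike R) (a b c : Fin 4) : R a b c c = 0 :=
  self_eq_neg.mp (hR.antisymm_right a b c c)

theorem IsCurvatureLike.einsteinContraction_comm (hR : IsCurvatureLike R) (a b : Fin 4) :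
    einsteinContraction R a b = einsteinContraction R b a := by
  simp only [einsteinContraction, g_comm a b, ricciContraction, hR.pair_symm _ a _ b]

theorem IsCurvatureLike.dual_dual (hR : IsCurvatureLike R) (h₀ : ∀ a b d, R a b 0 d = 0)
    (α β : Fin 3) :
    R (α + 1).succ (α + 2).succ (β + 1).succ (β + 2).succ =
      -einsteinContraction R α.succ β.succ := by
  have h₀' (a b c : Fin 4) : R a b c 0 = 0 := by rw [hR.antisymm_right, h₀, neg_zero]
  simp only [einsteinContraction, ricciContraction, Fin.sum_univ_four, h₀, h₀']
  have hl := hR.antisymm_left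
  have hr := hR.antisymm_right
  have hp := hR.pair_symm
  fin_cases α <;> fin_cases β <;>
    simp [g_eq, hR.eq_zero_left, hR.eq_zero_right, hl 2 1, hl 3 1, hl 3 2, hr _ _ 2 1, hr _ _ 3 1,
        hr _ _ 3 2, hp 2 3 1 2, hp 2 3 1 3, hp 1 3 1 2] <;> ring

theorem IsCurvatureLike.einsteinContraction_eq_zero_iff (hR : IsCurvatureLike R)
    (h₀ : ∀ a b d, R a b 0 d = 0) :
    (∀ a b, einsteinContraction R a b = 0) ↔
      ∀ α β : Fin 3, einsteinContraction R α.succ β.succ = 0 := by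
  refine ⟨fun hE α β => hE _ _, fun hE => ?_⟩
  have hric (b : Fin 4) : ricciContraction R b 0 = 0 :=
    Finset.sum_eq_zero fun a _ => by rw [hR.antisymm_right, h₀, neg_zero, mul_zero]
  have h_time : einsteinContraction R 0 0 = 0 := by
    have htrace : einsteinContraction R 0 0
        = -∑ α : Fin 3, einsteinContraction R α.succ α.succ := by
      simp only [einsteinContraction, Fin.sum_univ_succ, hric]
      simp [g_eq]
      ring
    rw [htrace, Finset.sum_eq_zero fun α _ => hE α α, neg_zero]
  have h_mixed (α : Fin 3) : einsteinContraction R α.succ 0 = 0 := by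
    rw [einsteinContraction, hric, g_of_ne (Fin.succ_ne_zero α), mul_zero, sub_zero]
  intro a b
  induction a using Fin.cases <;> induction b using Fin.cases
  · exact h_time
  · rw [hR.einsteinContraction_comm, h_mixed]
  · exact h_mixed _
  · exact hE _ _

variable (R) in
/-- The matrix `R^a_bcd`, with `c` and `d` fixed. -/
def raiseMatrix (c d : Fin 4) : Matrix (Fin 4) (Fin 4) ℝ := Matrix.of fun a b => g a a * R a b c d

theorem raiseMatrix_sub (R R' : Fin 4 → Fin 4 → Fin 4 → Fin 4 → ℝ) (c d : Fin 4) :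
    raiseMatrix (fun a b c d => R a b c d - R' a b c d) c d =
      raiseMatrix R c d - raiseMatrix R' c d := by
  ext a b
  simp [raiseMatrix, mul_sub]

theorem IsCurvatureLike.raiseMatrix_eq_lorentzGen (hR : IsCurvatureLike R) (c d : Fin 4) :
    raiseMatrix R c d = lorentzGen
      (fun α => -R 0 α.succ c d, fun α => -R (α + 1).succ (α + 2).succ c d) := by
  have hl (a b : Fin 4) := hR.antisymm_left a b c d
  ext a b
  fin_cases a <;> fin_cases b <;>
    simp [raiseMatrix, lorentzGen, g_eq, hR.eq_zero_left, hl 1 0, hl 2 0, hl 3 0, hl 2 1, hl 1 3,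
      hl 3 2]

end EinsteinContraction

namespace Fields

open Filter Topology

variable {S : Fields} {U : Set Pt} {x : Pt}

section FrameDerivative

variable {F : Type*} [NormedAddCommGroup F] [NormedSpace ℝ F] {f f' : Pt → F}

variable (S) in
/-- The directional derivative along `e_a` of a vector-valued function; `dd` is its real-valued
case. -/
def frameDeriv (a : Fin 4) (f : Pt → F) (x : Pt) : F := fderiv ℝ f x (S.e a x)

theorem frameDeriv_congr (a : Fin 4) (hf : f =ᶠ[𝓝 x] f') :
    S.frameDeriv a f x = S.frameDeriv a f' x := by
  rw [frameDeriv, frameDeriv, hf.fderiv_eq]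

theorem frameDeriv_add (a : Fin 4) (hf : DifferentiableAt ℝ f x) (hf' : DifferentiableAt ℝ f' x) :
    S.frameDeriv a (fun y => f y + f' y) x = S.frameDeriv a f x + S.frameDeriv a f' x := by
  simp [frameDeriv, fderiv_fun_add hf hf']

theorem frameDeriv_sub (a : Fin 4) (hf : DifferentiableAt ℝ f x) (hf' : DifferentiableAt ℝ f' x) :
    S.frameDeriv a (fun y => f y - f' y) x = S.frameDeriv a f x - S.frameDeriv a f' x := by
  simp [frameDeriv, fderiv_fun_sub hf hf']

theorem frameDeriv_neg (a : Fin 4) (f : Pt → F) :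
    S.frameDeriv a (fun y => -f y) x = -S.frameDeriv a f x := by
  simp [frameDeriv, fderiv_fun_neg]

theorem frameDeriv_sum {ι : Type*} (s : Finset ι) {f : ι → Pt → F} (a : Fin 4)
    (hf : ∀ i ∈ s, DifferentiableAt ℝ (f i) x) :
    S.frameDeriv a (fun y => ∑ i ∈ s, f i y) x = ∑ i ∈ s, S.frameDeriv a (f i) x := by
  simp [frameDeriv, fderiv_fun_sum hf]

theorem frameDeriv_smul {r : Pt → ℝ} (a : Fin 4) (hr : DifferentiableAt ℝ r x)
    (hf : DifferentiableAt ℝ f x) :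
    S.frameDeriv a (fun y => r y • f y) x = S.dd a r x • f x + r x • S.frameDeriv a f x := by
  simp [frameDeriv, dd, fderiv_fun_smul hr hf, add_comm]

theorem frameDeriv_mul {A : Type*} [NormedRing A] [NormedAlgebra ℝ A] {M N : Pt → A} (a : Fin 4)
    (hM : DifferentiableAt ℝ M x) (hN : DifferentiableAt ℝ N x) :
    S.frameDeriv a (fun y => M y * N y) x =
      S.frameDeriv a M x * N x + M x * S.frameDeriv a N x := by
  simp [frameDeriv, fderiv_fun_mul' hM hN, add_comm]

theorem frameDeriv_lie {A : Type*} [NormedRing A] [NormedAlgebra ℝ A] {M N : Pt → A} (a : Fin 4)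
    (hM : DifferentiableAt ℝ M x) (hN : DifferentiableAt ℝ N x) :
    S.frameDeriv a (fun y => ⁅M y, N y⁆) x =
      ⁅S.frameDeriv a M x, N x⁆ + ⁅M x, S.frameDeriv a N x⁆ := by
  simp only [Ring.lie_def]
  rw [frameDeriv_sub a (hM.fun_mul hN) (hN.fun_mul hM), frameDeriv_mul a hM hN,
    frameDeriv_mul a hN hM]
  abel

theorem frameDeriv_frameDeriv_sub (hf : ContDiffAt ℝ ∞ f x)
    {a b : Fin 4} (ha : DifferentiableAt ℝ (S.e a) x) (hb : DifferentiableAt ℝ (S.e b) x)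
    (hcomm : VectorField.lieBracket ℝ (S.e a) (S.e b) x = ∑ c, S.γ c a b x • S.e c x) :
    S.frameDeriv a (S.frameDeriv b f) x - S.frameDeriv b (S.frameDeriv a f) x =
      ∑ c, S.γ c a b x • S.frameDeriv c f x := by
  have hlie := VectorField.fderiv_apply_lieBracket hf
    (minSmoothness_of_isRCLikeNormedField.trans_le ENat.LEInfty.out) hb ha
  rw [hcomm] at hlie
  simp only [map_sum, map_smul] at hlie
  exact hlie.symm

theorem contDiffAt_frameDeriv {a : Fin 4} (he : ContDiffAt ℝ ∞ (S.e a) x)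
    (hf : ContDiffAt ℝ ∞ f x) : ContDiffAt ℝ ∞ (S.frameDeriv a f) x :=
  (hf.fderiv_right (m := ∞) (by simp)).clm_apply he

end FrameDerivative

section Connection

attribute [local instance] LieRing.ofAssociativeRing

variable {A : Type*} [NormedRing A] [NormedAlgebra ℝ A] {W : Fin 4 → Pt → A}

variable (S) in
/-- The derivative `∂_c M + [W_c, M]` of an algebra-valued function along `e_c` with respect to
the connection form `W`. -/
def covD (W : Fin 4 → Pt → A) (c : Fin 4) (M : Pt → A) (x : Pt) : A :=
  S.frameDeriv c M x + ⁅W c x, M x⁆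

variable (S) in
/-- The components `∂_c W_d - ∂_d W_c + [W_c, W_d] - γ^f_cd W_f` of the curvature form of the
connection form `W`. -/
def curvature (W : Fin 4 → Pt → A) (c d : Fin 4) (x : Pt) : A :=
  S.frameDeriv c (W d) x - S.frameDeriv d (W c) x + ⁅W c x, W d x⁆ - ∑ f, S.γ f c d x • W f x

variable (S) in
/-- The components of the exterior covariant derivative of the algebra-valued 2-form with tetrad
components `k c d`. -/
def extCovD (W : Fin 4 → Pt → A) (k : Fin 4 → Fin 4 → Pt → A) (c d e : Fin 4) (x : Pt) : A :=
  S.covD W c (k d e) x + S.covD W d (k e c) x + S.covD W e (k c d) x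
    - (∑ f, S.γ f c d x • k f e x + ∑ f, S.γ f d e x • k f c x + ∑ f, S.γ f e c x • k f d x)

theorem covD_congr {M N : Pt → A} (c : Fin 4) (hMN : M =ᶠ[𝓝 x] N) :
    S.covD W c M x = S.covD W c N x := by
  rw [covD, covD, frameDeriv_congr c hMN, hMN.eq_of_nhds]

theorem covD_neg (c : Fin 4) (M : Pt → A) :
    S.covD W c (fun y => -M y) x = -S.covD W c M x := by
  rw [covD, covD, frameDeriv_neg, lie_neg, neg_add]

theorem covD_add {M N : Pt → A} (c : Fin 4) (hM : DifferentiableAt ℝ M x)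
    (hN : DifferentiableAt ℝ N x) :
    S.covD W c (fun y => M y + N y) x = S.covD W c M x + S.covD W c N x := by
  rw [covD, covD, covD, frameDeriv_add c hM hN, lie_add]
  abel

theorem covD_sum {ι : Type*} (s : Finset ι) {M : ι → Pt → A} (c : Fin 4)
    (hM : ∀ i ∈ s, DifferentiableAt ℝ (M i) x) :
    S.covD W c (fun y => ∑ i ∈ s, M i y) x = ∑ i ∈ s, S.covD W c (M i) x := by
  simp only [covD, frameDeriv_sum s c hM, lie_sum, Finset.sum_add_distrib]

theorem covD_smul {r : Pt → ℝ} {M : Pt → A} (c : Fin 4) (hr : DifferentiableAt ℝ r x)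
    (hM : DifferentiableAt ℝ M x) :
    S.covD W c (fun y => r y • M y) x = S.dd c r x • M x + r x • S.covD W c M x := by
  rw [covD, covD, frameDeriv_smul c hr hM, lie_smul, smul_add, add_assoc]

theorem contDiffAt_covD {M : Pt → A} {c : Fin 4} (he : ContDiffAt ℝ ∞ (S.e c) x)
    (hW : ContDiffAt ℝ ∞ (W c) x) (hM : ContDiffAt ℝ ∞ M x) :
    ContDiffAt ℝ ∞ (S.covD W c M) x :=
  (contDiffAt_frameDeriv he hM).add ((hW.mul hM).sub (hM.mul hW))

theorem covD_covD {M : Pt → A} {c d : Fin 4} (he : ContDiffAt ℝ ∞ (S.e d) x)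
    (hW : DifferentiableAt ℝ (W d) x) (hM : ContDiffAt ℝ ∞ M x) :
    S.covD W c (S.covD W d M) x = S.frameDeriv c (S.frameDeriv d M) x
      + ⁅S.frameDeriv c (W d) x, M x⁆ + ⁅W d x, S.frameDeriv c M x⁆
      + ⁅W c x, S.frameDeriv d M x⁆ + ⁅W c x, ⁅W d x, M x⁆⁆ := by
  have hM₁ : DifferentiableAt ℝ M x := hM.differentiableAt (by simp)
  have hM₂ : DifferentiableAt ℝ (S.frameDeriv d M) x :=
    (contDiffAt_frameDeriv he hM).differentiableAt (by simp)
  have hlie : DifferentiableAt ℝ (fun y => ⁅W d y, M y⁆) x := (hW.mul hM₁).sub (hM₁.mul hW)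
  change S.frameDeriv c (fun y => S.frameDeriv d M y + ⁅W d y, M y⁆) x
    + ⁅W c x, S.frameDeriv d M x + ⁅W d x, M x⁆⁆ = _
  rw [frameDeriv_add c hM₂ hlie, frameDeriv_lie c hW hM₁, lie_add]
  abel

theorem covD_covD_sub_covD_covD {M : Pt → A} (hM : ContDiffAt ℝ ∞ M x) {a b : Fin 4}
    (ha : ContDiffAt ℝ ∞ (S.e a) x) (hb : ContDiffAt ℝ ∞ (S.e b) x)
    (hWa : DifferentiableAt ℝ (W a) x) (hWb : DifferentiableAt ℝ (W b) x)
    (hcomm : VectorField.lieBracket ℝ (S.e a) (S.e b) x = ∑ c, S.γ c a b x • S.e c x) :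
    S.covD W a (S.covD W b M) x - S.covD W b (S.covD W a M) x =
      ∑ f, S.γ f a b x • S.covD W f M x + ⁅S.curvature W a b x, M x⁆ := by
  have hd := frameDeriv_frameDeriv_sub hM (ha.differentiableAt (by simp))
    (hb.differentiableAt (by simp)) hcomm
  rw [covD_covD hb hWb hM, covD_covD ha hWa hM]
  simp only [curvature, covD, smul_add,
    Finset.sum_add_distrib, ← hd, sub_lie, add_lie, lie_lie, sum_lie, smul_lie]
  abel

end Connection

section Tetrad

theorem IsRegularOn.contDiffAt_e (hS : S.IsRegularOn U) (hU : IsOpen U) (hx : x ∈ U) (a : Fin 4) :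
    ContDiffAt ℝ ∞ (S.e a) x :=
  (hS.smooth_e a).contDiffAt (hU.mem_nhds hx)

theorem IsRegularOn.contDiffAt_γ (hS : S.IsRegularOn U) (hU : IsOpen U) (hx : x ∈ U)
    (c a b : Fin 4) : ContDiffAt ℝ ∞ (S.γ c a b) x :=
  (hS.smooth_γ c a b).contDiffAt (hU.mem_nhds hx)

theorem IsRegularOn.γ_antisymm (hS : S.IsRegularOn U) (hx : x ∈ U) (c a b : Fin 4) :
    S.γ c a b x = -S.γ c b a x := by
  have hsum : ∑ c, (S.γ c a b x + S.γ c b a x) • S.e c x = 0 := by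
    simp only [add_smul, Finset.sum_add_distrib]
    rw [← hS.commutators x hx a b, ← hS.commutators x hx b a, VectorField.lieBracket_swap]
    simp
  exact eq_neg_of_add_eq_zero_left
    (Fintype.linearIndependent_iff.mp (hS.linInd x hx) _ hsum c)

end Tetrad

section LeviCivita

theorem γLow_eq (c a b : Fin 4) (x : Pt) : S.γLow c a b x = g c c * S.γ c a b x :=
  sum_g_mul c fun d => S.γ d a b x

theorem Γ_eq (c a b : Fin 4) (x : Pt) : S.Γ c a b x = g c c * S.ΓLow c a b x :=
  sum_g_mul c fun d => S.ΓLow d a b x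

theorem IsRegularOn.contDiffAt_Γ (hS : S.IsRegularOn U) (hU : IsOpen U) (hx : x ∈ U)
    (c a b : Fin 4) : ContDiffAt ℝ ∞ (S.Γ c a b) x := by
  have hγ := hS.contDiffAt_γ hU hx
  unfold Γ ΓLow γLow
  fun_prop

theorem IsRegularOn.differentiableAt_Γ (hS : S.IsRegularOn U) (hU : IsOpen U) (hx : x ∈ U)
    (c a b : Fin 4) : DifferentiableAt ℝ (S.Γ c a b) x :=
  (hS.contDiffAt_Γ hU hx c a b).differentiableAt (by simp)

theorem IsRegularOn.Γ_sub_Γ (hS : S.IsRegularOn U) (hx : x ∈ U) (c a b : Fin 4) :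
    S.Γ c b a x - S.Γ c a b x = S.γ c a b x := by
  simp only [Γ_eq, ΓLow, γLow_eq]
  rw [hS.γ_antisymm hx c b a]
  linear_combination S.γ c a b x * g_mul_self c

theorem IsRegularOn.dd_Γ_sub_dd_Γ (hS : S.IsRegularOn U) (hU : IsOpen U) (hx : x ∈ U)
    (f c a b : Fin 4) :
    S.dd f (S.Γ c b a) x - S.dd f (S.Γ c a b) x = S.dd f (S.γ c a b) x :=
  (frameDeriv_sub f (hS.differentiableAt_Γ hU hx c b a) (hS.differentiableAt_Γ hU hx c a b)).symm
    |>.trans (frameDeriv_congr f (eventually_of_mem (hU.mem_nhds hx) fun _ hy =>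
      hS.Γ_sub_Γ hy c a b))

theorem IsRegularOn.g_mul_Γ_antisymm (hS : S.IsRegularOn U) (hx : x ∈ U) (a b c : Fin 4) :
    g a a * S.Γ a b c x = -(g b b * S.Γ b a c x) := by
  simp only [Γ_eq, ΓLow, γLow_eq, ← mul_assoc, g_mul_self]
  rw [hS.γ_antisymm hx c a b]
  ring

theorem IsRegularOn.g_mul_dd_Γ_antisymm (hS : S.IsRegularOn U) (hU : IsOpen U) (hx : x ∈ U)
    (f a b c : Fin 4) :
    g a a * S.dd f (S.Γ a b c) x = -(g b b * S.dd f (S.Γ b a c) x) := by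
  have hcongr := frameDeriv_congr (S := S) f (eventually_of_mem (hU.mem_nhds hx) fun _ hy =>
    hS.g_mul_Γ_antisymm hy a b c)
  simpa [dd, frameDeriv, fderiv_const_mul (hS.differentiableAt_Γ hU hx _ _ _)] using hcongr

end LeviCivita

section RiemannTensor

theorem IsRegularOn.riemann_antisymm (hS : S.IsRegularOn U) (hx : x ∈ U) (a b c d : Fin 4) :
    S.riemann a b c d x = -S.riemann a b d c x := by
  simp only [riemann, neg_add, neg_sub, ← Finset.sum_neg_distrib]
  congr 1
  refine Finset.sum_congr rfl fun f _ => ?_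
  rw [hS.γ_antisymm hx f c d]
  ring

theorem IsRegularOn.g_mul_riemann_antisymm (hS : S.IsRegularOn U) (hU : IsOpen U) (hx : x ∈ U)
    (a b c d : Fin 4) :
    g a a * S.riemann a b c d x = -(g b b * S.riemann b a c d x) := by
  have hΓ := hS.g_mul_Γ_antisymm hx
  have hsum : g a a * ∑ f, (S.Γ f b d x * S.Γ a f c x - S.Γ f b c x * S.Γ a f d x
        - S.γ f c d x * S.Γ a b f x)
      = -(g b b * ∑ f, (S.Γ f a d x * S.Γ b f c x - S.Γ f a c x * S.Γ b f d x
        - S.γ f c d x * S.Γ b a f x)) := by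
    simp only [Finset.mul_sum, ← Finset.sum_neg_distrib]
    refine Finset.sum_congr rfl fun f _ => ?_
    linear_combination S.Γ f b d x * hΓ a f c - S.Γ f b c x * hΓ a f d - S.γ f c d x * hΓ a b f
      - S.Γ f a c x * hΓ f b d + S.Γ f a d x * hΓ f b c
  simp only [riemann]
  linear_combination hsum + hS.g_mul_dd_Γ_antisymm hU hx c a b d
    - hS.g_mul_dd_Γ_antisymm hU hx d a b c

theorem IsRegularOn.riemann_cyclic (hS : S.IsRegularOn U) (hU : IsOpen U) (hx : x ∈ U)
    (hJ : S.Jacobi x) (a b c d : Fin 4) :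
    S.riemann a b c d x + S.riemann a c d b x + S.riemann a d b c x = 0 := by
  have hsum : ∑ f, (S.Γ f b d x * S.Γ a f c x - S.Γ f b c x * S.Γ a f d x
        - S.γ f c d x * S.Γ a b f x)
      + ∑ f, (S.Γ f c b x * S.Γ a f d x - S.Γ f c d x * S.Γ a f b x
        - S.γ f d b x * S.Γ a c f x)
      + ∑ f, (S.Γ f d c x * S.Γ a f b x - S.Γ f d b x * S.Γ a f c x
        - S.γ f b c x * S.Γ a d f x)
      = - ∑ f, (S.γ a f b x * S.γ f c d x + S.γ a f c x * S.γ f d b x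
          + S.γ a f d x * S.γ f b c x) := by
    simp only [← Finset.sum_add_distrib, ← Finset.sum_neg_distrib, ← hS.Γ_sub_Γ hx]
    exact Finset.sum_congr rfl fun f _ => by ring
  simp only [riemann]
  linear_combination hsum + hJ b c d a + hS.dd_Γ_sub_dd_Γ hU hx c a d b
    + hS.dd_Γ_sub_dd_Γ hU hx d a b c + hS.dd_Γ_sub_dd_Γ hU hx b a c d

variable (S) in
/-- The fully covariant curvature `R_abcd`. -/
def riemannLow (x : Pt) (a b c d : Fin 4) : ℝ := g a a * S.riemann a b c d x

theorem IsRegularOn.isCurvatureLike_riemannLow (hS : S.IsRegularOn U) (hU : IsOpen U)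
    (hx : x ∈ U) (hJ : S.Jacobi x) : IsCurvatureLike (S.riemannLow x) := by
  refine .of_cyclic (fun a b c d => hS.g_mul_riemann_antisymm hU hx a b c d)
    (fun a b c d => ?_) fun a b c d => ?_
  · rw [riemannLow, riemannLow, hS.riemann_antisymm hx, mul_neg]
  · simp only [riemannLow, ← mul_add, hS.riemann_cyclic hU hx hJ, mul_zero]

theorem covVec_uUp (a c : Fin 4) : S.covVec (fun b _ => uUp b) a c = S.Γ a 0 c := by
  funext y
  simp [covVec, dd, uUp]

theorem IsRegularOn.riemann_zero (hS : S.IsRegularOn U) (hx : x ∈ U) (hR : S.RicciU x)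
    (a c d : Fin 4) : S.riemann a 0 c d x = S.KUp a 0 c d x := by
  have hsum : ∑ f, (S.Γ f 0 d x * S.Γ a f c x - S.Γ f 0 c x * S.Γ a f d x
        - S.γ f c d x * S.Γ a 0 f x)
      = ∑ f, (S.Γ a f c x * S.Γ f 0 d x - S.Γ f d c x * S.Γ a 0 f x)
        - ∑ f, (S.Γ a f d x * S.Γ f 0 c x - S.Γ f c d x * S.Γ a 0 f x) := by
    simp only [← Finset.sum_sub_distrib, ← hS.Γ_sub_Γ hx]
    exact Finset.sum_congr rfl fun f _ => by ring
  rw [← hR a d c]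
  simp only [covVec2, covVec_uUp, riemann]
  linear_combination hsum

end RiemannTensor

section Integrability

attribute [local instance] LieRing.ofAssociativeRing

variable {A : Type*} [NormedRing A] [NormedAlgebra ℝ A] {W : Fin 4 → Pt → A}
  {k : Fin 4 → Fin 4 → Pt → A}

theorem Jacobi.sum_dd_γ_smul_cyclic {V : Type*} [AddCommGroup V] [Module ℝ V]
    (hJ : S.Jacobi x) (a b c : Fin 4) (v : Fin 4 → V) :
    ∑ i, S.dd a (S.γ i b c) x • v i + ∑ i, S.dd b (S.γ i c a) x • v i
        + ∑ i, S.dd c (S.γ i a b) x • v i =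
      ∑ f, S.γ f b c x • ∑ i, S.γ i f a x • v i + ∑ f, S.γ f c a x • ∑ i, S.γ i f b x • v i
        + ∑ f, S.γ f a b x • ∑ i, S.γ i f c x • v i := by
  simp only [Finset.smul_sum, smul_smul, ← Finset.sum_add_distrib, ← add_smul]
  rw [Finset.sum_comm]
  refine Finset.sum_congr rfl fun i _ => ?_
  rw [sub_eq_zero.mp (hJ a b c i), Finset.sum_smul]
  exact Finset.sum_congr rfl fun f _ => by congr 1; ring

theorem IsRegularOn.covD_sum_γ_smul (hS : S.IsRegularOn U) (hU : IsOpen U) (hx : x ∈ U)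
    {v : Fin 4 → Pt → A} (hv : ∀ f, DifferentiableAt ℝ (v f) x) (a b c : Fin 4) :
    S.covD W a (fun y => ∑ f, S.γ f b c y • v f y) x =
      ∑ f, S.dd a (S.γ f b c) x • v f x + ∑ f, S.γ f b c x • S.covD W a (v f) x := by
  have hγ (f : Fin 4) : DifferentiableAt ℝ (S.γ f b c) x :=
    (hS.contDiffAt_γ hU hx f b c).differentiableAt (by simp)
  rw [covD_sum _ a fun f _ => (hγ f).fun_smul (hv f), ← Finset.sum_add_distrib]
  exact Finset.sum_congr rfl fun f _ => covD_smul a (hγ f) (hv f)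

theorem IsRegularOn.covD_covD_cyclic (hS : S.IsRegularOn U) (hU : IsOpen U) (hx : x ∈ U)
    (hW : ∀ c, ContDiffAt ℝ ∞ (W c) x) (hk : ∀ c d, ContDiffAt ℝ ∞ (k c d) x)
    {b c d : Fin 4} (hext : ∀ y ∈ U, S.extCovD W k b c d y = 0) (a : Fin 4) :
    S.covD W a (S.covD W b (k c d)) x + S.covD W a (S.covD W c (k d b)) x
        + S.covD W a (S.covD W d (k b c)) x =
      (∑ f, S.dd a (S.γ f b c) x • k f d x + ∑ f, S.γ f b c x • S.covD W a (k f d) x)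
        + (∑ f, S.dd a (S.γ f c d) x • k f b x + ∑ f, S.γ f c d x • S.covD W a (k f b) x)
        + (∑ f, S.dd a (S.γ f d b) x • k f c x + ∑ f, S.γ f d b x • S.covD W a (k f c) x) := by
  have hk₁ (c d : Fin 4) : DifferentiableAt ℝ (k c d) x := (hk c d).differentiableAt (by simp)
  have hDk (a c d : Fin 4) : DifferentiableAt ℝ (S.covD W a (k c d)) x :=
    (contDiffAt_covD (hS.contDiffAt_e hU hx a) (hW a) (hk c d)).differentiableAt (by simp)
  have hγk (a b d : Fin 4) : DifferentiableAt ℝ (fun y => ∑ f, S.γ f a b y • k f d y) x :=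
    .fun_sum fun f _ =>
      ((hS.contDiffAt_γ hU hx f a b).differentiableAt (by simp)).fun_smul (hk₁ f d)
  have hcongr := covD_congr (S := S) (W := W) a (eventually_of_mem (hU.mem_nhds hx) fun y hy =>
    sub_eq_zero.mp (hext y hy))
  rwa [covD_add a ((hDk b c d).fun_add (hDk c d b)) (hDk d b c),
    covD_add a (hDk b c d) (hDk c d b),
    covD_add a ((hγk b c d).fun_add (hγk c d b)) (hγk d b c),
    covD_add a (hγk b c d) (hγk c d b), hS.covD_sum_γ_smul hU hx (hk₁ · d),
    hS.covD_sum_γ_smul hU hx (hk₁ · b), hS.covD_sum_γ_smul hU hx (hk₁ · c)] at hcongr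

theorem IsRegularOn.covD_covD_add_covD_covD (hS : S.IsRegularOn U) (hU : IsOpen U) (hx : x ∈ U)
    (hW : ∀ c, ContDiffAt ℝ ∞ (W c) x) (hk : ∀ c d, ContDiffAt ℝ ∞ (k c d) x)
    (hanti : ∀ c d y, k c d y = -k d c y) (a b c d : Fin 4) :
    S.covD W a (S.covD W b (k c d)) x + S.covD W b (S.covD W a (k d c)) x =
      ∑ f, S.γ f a b x • S.covD W f (k c d) x + ⁅S.curvature W a b x, k c d x⁆ := by
  have hDanti : S.covD W a (k d c) = fun y => -S.covD W a (k c d) y := by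
    funext y
    rw [show k d c = fun y => -k c d y from funext (hanti d c), covD_neg]
  rw [hDanti, covD_neg, ← sub_eq_add_neg]
  exact covD_covD_sub_covD_covD (hk c d) (hS.contDiffAt_e hU hx a) (hS.contDiffAt_e hU hx b)
    ((hW a).differentiableAt (by simp)) ((hW b).differentiableAt (by simp))
    (hS.commutators x hx a b)

theorem IsRegularOn.sum_γ_smul_covD (hS : S.IsRegularOn U) (hx : x ∈ U)
    (hanti : ∀ c d y, k c d y = -k d c y) {c d : Fin 4}
    (hext : ∀ f, S.extCovD W k f c d x = 0) (a b : Fin 4) :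
    ∑ f, S.γ f a b x • S.covD W f (k c d) x =
      ∑ f, S.γ f a b x • S.covD W c (k f d) x + ∑ f, S.γ f b a x • S.covD W d (k f c) x
        + ∑ f, S.γ f a b x • ∑ i, S.γ i f c x • k i d x
        + ∑ f, S.γ f b a x • ∑ i, S.γ i f d x • k i c x
        + ∑ f, S.γ f a b x • ∑ i, S.γ i c d x • k i f x := by
  simp only [← Finset.sum_add_distrib]
  refine Finset.sum_congr rfl fun f _ => ?_
  have hD : S.covD W c (k d f) x = -S.covD W c (k f d) x := by
    rw [show k d f = fun y => -k f d y from funext (hanti d f), covD_neg]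
  have hγ : ∑ i, S.γ i d f x • k i c x = -∑ i, S.γ i f d x • k i c x := by
    simp only [hS.γ_antisymm hx _ d f, neg_smul, Finset.sum_neg_distrib]
  have hf := hext f
  rw [extCovD, hD, hγ] at hf
  rw [hS.γ_antisymm hx f b a]
  linear_combination (norm := module) S.γ f a b x • hf

theorem sum_γ_smul_sum_γ_smul_swap (hanti : ∀ c d y, k c d y = -k d c y) (a b c d : Fin 4) :
    ∑ f, S.γ f a b x • ∑ i, S.γ i c d x • k i f x =
      -∑ f, S.γ f c d x • ∑ i, S.γ i a b x • k i f x := by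
  simp only [Finset.smul_sum, ← Finset.sum_neg_distrib]
  rw [Finset.sum_comm]
  refine Finset.sum_congr rfl fun i _ => Finset.sum_congr rfl fun f _ => ?_
  rw [hanti i f, smul_comm, smul_neg, smul_neg]

theorem IsRegularOn.sum_lie_curvature_eq_zero (hS : S.IsRegularOn U) (hU : IsOpen U) (hx : x ∈ U)
    (hJ : S.Jacobi x) (hW : ∀ c, ContDiffAt ℝ ∞ (W c) x) (hk : ∀ c d, ContDiffAt ℝ ∞ (k c d) x)
    (hanti : ∀ c d y, k c d y = -k d c y)
    (hext : ∀ y ∈ U, ∀ c d e, S.extCovD W k c d e y = 0) (a b c d : Fin 4) :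
    ⁅S.curvature W a b x, k c d x⁆ + ⁅S.curvature W a c x, k d b x⁆
      + ⁅S.curvature W a d x, k b c x⁆ + ⁅S.curvature W c d x, k a b x⁆
      + ⁅S.curvature W d b x, k a c x⁆ + ⁅S.curvature W b c x, k a d x⁆ = 0 := by
  have hcyc (a b c d : Fin 4) :=
    hS.covD_covD_cyclic hU hx hW hk (fun y hy => hext y hy b c d) a
  have hricci := hS.covD_covD_add_covD_covD hU hx hW hk hanti
  have hcontr (a b c d : Fin 4) := hS.sum_γ_smul_covD hx hanti (fun f => hext x hx f c d) a b
  have hjacobi (a b c d : Fin 4) := hJ.sum_dd_γ_smul_cyclic a b c fun f => k f d x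
  have hswap := sum_γ_smul_sum_γ_smul_swap (S := S) (x := x) hanti
  linear_combination (norm := module)
    hcyc a b c d + hcyc b c a d + hcyc c a b d + hcyc d b a c
    - (hricci a b c d + hricci a c d b + hricci a d b c
      + hricci c d a b + hricci d b a c + hricci b c a d)
    - (hcontr a b c d + hcontr a c d b + hcontr a d b c
      + hcontr c d a b + hcontr d b a c + hcontr b c a d)
    + hjacobi a b c d + hjacobi a c d b + hjacobi a d b c + hjacobi b d c a
    - (hswap a b c d + hswap a c d b + hswap a d b c)

end Integrability

section CurvatureVariable

theorem IsRegularOn.T_symm (hS : S.IsRegularOn U) (hx : x ∈ U) (a b : Fin 4) :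
    S.T a b x = S.T b a x := by
  simp only [T]
  rw [extMat_symm (hS.symm_aniso x hx) a b, h_comm a b]
  ring

theorem IsRegularOn.ric_symm (hS : S.IsRegularOn U) (hx : x ∈ U) (a b : Fin 4) :
    S.ric a b x = S.ric b a x := by
  rw [ric, ric, hS.T_symm hx a b, g_comm a b]

theorem K_antisymm (a b c d : Fin 4) (x : Pt) : S.K a b c d x = -S.K a b d c x := by
  simp only [K, weyl, eps_antisymm d c, mul_sub, neg_mul, Finset.sum_sub_distrib,
    Finset.sum_neg_distrib]
  ring

theorem K_antisymm_left (a b c d : Fin 4) (x : Pt) : S.K a b c d x = -S.K b a c d x := by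
  simp only [K, weyl, eps_antisymm b a, mul_sub, neg_mul, Finset.sum_sub_distrib,
    Finset.sum_neg_distrib]
  rw [g_comm c a, g_comm c b, g_comm d a, g_comm d b]
  ring

theorem IsRegularOn.K_pair_symm (hS : S.IsRegularOn U) (hx : x ∈ U) (a b c d : Fin 4) :
    S.K a b c d x = S.K c d a b x := by
  simp only [K, weyl]
  rw [extMat_symm (hS.symm_E x hx) d b, extMat_symm (hS.symm_E x hx) c b,
    extMat_symm (hS.symm_E x hx) d a, extMat_symm (hS.symm_E x hx) c a, h_comm c a, h_comm d a,
    h_comm c b, h_comm d b, g_comm c a, g_comm c b, g_comm d a, g_comm d b, hS.ric_symm hx d b,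
    hS.ric_symm hx c b, hS.ric_symm hx c a, hS.ric_symm hx d a]
  ring

theorem IsRegularOn.isCurvatureLike_K (hS : S.IsRegularOn U) (hx : x ∈ U) :
    IsCurvatureLike fun a b c d => S.K a b c d x where
  antisymm_left a b c d := K_antisymm_left a b c d x
  antisymm_right a b c d := K_antisymm a b c d x
  pair_symm := hS.K_pair_symm hx

theorem trT_eq_sum (x : Pt) : S.trT x = ∑ a, g a a * S.T a a x := by
  simp only [trT, sum_g_mul]

theorem IsRegularOn.trT_eq (hS : S.IsRegularOn U) (hx : x ∈ U) :
    S.trT x = 3 * S.p x - S.ρ x := by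
  have htrace := hS.trace_aniso x hx
  rw [Matrix.trace_fin_three] at htrace
  simp [trT_eq_sum, Fin.sum_univ_four, T, g_eq, h_eq, uLow_eq, extMat_eq, extVec_eq]
  linarith

theorem sum_g_mul_ric (x : Pt) : ∑ a, g a a * S.ric a a x = -S.trT x := by
  have hT := trT_eq_sum (S := S) x
  simp only [Fin.sum_univ_four, g_eq, ric] at hT ⊢
  simp at hT ⊢
  linarith

theorem IsRegularOn.ricciContraction_weyl (hS : S.IsRegularOn U) (hx : x ∈ U) (b d : Fin 4) :
    ricciContraction (fun a b c d => S.weyl a b c d x) b d = 0 := by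
  have hE := hS.trace_E x hx
  rw [Matrix.trace_fin_three] at hE
  have hEs := (hS.symm_E x hx).apply
  have hHs := (hS.symm_H x hx).apply
  simp only [ricciContraction, weyl, eps_eq, h_eq, g_eq, uLow_eq, extMat_eq, Fin.sum_univ_four]
  fin_cases b <;> fin_cases d <;> simp <;>
    linarith [hEs 0 1, hEs 0 2, hEs 1 2, hHs 0 1, hHs 0 2, hHs 1 2]

theorem IsRegularOn.ricciContraction_K (hS : S.IsRegularOn U) (hx : x ∈ U) (b d : Fin 4) :
    ricciContraction (fun a b c d => S.K a b c d x) b d = S.ric b d x := by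
  have hRs := hS.ric_symm hx
  have htr := sum_g_mul_ric (S := S) x
  have hric : ricciContraction (fun a b c d => S.K a b c d x - S.weyl a b c d x) b d
      = S.ric b d x := by
    simp only [ricciContraction, K, g_eq, Fin.sum_univ_four] at htr ⊢
    fin_cases b <;> fin_cases d <;> simp at htr ⊢ <;>
      linarith [hRs 0 1, hRs 0 2, hRs 0 3, hRs 1 2, hRs 1 3, hRs 2 3]
  rw [ricciContraction_sub, hS.ricciContraction_weyl hx, sub_zero] at hric
  exact hric

theorem IsRegularOn.einsteinContraction_K (hS : S.IsRegularOn U) (hx : x ∈ U) (a b : Fin 4) :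
    einsteinContraction (fun a b c d => S.K a b c d x) a b = S.T a b x := by
  simp only [einsteinContraction, hS.ricciContraction_K hx, sum_g_mul_ric]
  rw [ric]
  ring

-- The constant is a third of `ric 0 0 = (ρ + 3p) / 2`, the trace of the left-hand side.
theorem IsRegularOn.K_electric (hS : S.IsRegularOn U) (hx : x ∈ U) (α β : Fin 3) :
    S.K 0 α.succ 0 β.succ x =
      (S.I x + ((S.ρ x + 3 * S.p x) / 6) • (1 : Matrix (Fin 3) (Fin 3) ℝ)) α β := by
  have hEs := (hS.symm_E x hx).apply
  have hPs := (hS.symm_aniso x hx).apply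
  simp only [K, weyl, ric, hS.trT_eq hx, T, I, eps_eq, h_eq, g_eq, uLow_eq, extMat_eq, extVec_eq,
    Fin.sum_univ_four]
  fin_cases α <;> fin_cases β <;> simp <;>
    linarith [hEs 0 1, hEs 0 2, hEs 1 2, hPs 0 1, hPs 0 2, hPs 1 2]

theorem J_eq (x : Pt) : S.J x = S.H x + (1 / 2 : ℝ) • crossMatrix (S.q x) := by
  ext α β
  fin_cases α <;> fin_cases β <;>
    simp [J, crossMatrix, Fin.sum_univ_four, extVec_eq, uUp, eta_zero_right] <;> ring

theorem IsRegularOn.K_magnetic (hS : S.IsRegularOn U) (hx : x ∈ U) (α β : Fin 3) :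
    S.K (α + 1).succ (α + 2).succ 0 β.succ x = -S.J x α β := by
  have hHs := (hS.symm_H x hx).apply
  simp only [K, weyl, ric, T, J_eq, eps_eq, h_eq, g_eq, uLow_eq, extMat_eq, extVec_eq,
    Fin.sum_univ_four]
  fin_cases α <;> fin_cases β <;> simp [crossMatrix] <;>
    linarith [hHs 0 1, hHs 0 2, hHs 1 2]

end CurvatureVariable

section Smoothness

theorem contDiffAt_extVec {v : Pt → Fin 3 → ℝ} (hv : ∀ α, ContDiffAt ℝ ∞ (fun y => v y α) x)
    (a : Fin 4) : ContDiffAt ℝ ∞ (fun y => extVec (v y) a) x := by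
  induction a using Fin.cases with
  | zero => exact contDiffAt_const
  | succ α => exact hv α

theorem contDiffAt_extMat {M : Pt → Matrix (Fin 3) (Fin 3) ℝ}
    (hM : ∀ α β, ContDiffAt ℝ ∞ (fun y => M y α β) x) (a b : Fin 4) :
    ContDiffAt ℝ ∞ (fun y => extMat (M y) a b) x := by
  induction a using Fin.cases with
  | zero => exact contDiffAt_const
  | succ α =>
    induction b using Fin.cases with
    | zero => exact contDiffAt_const
    | succ β => exact hM α β

theorem IsRegularOn.contDiffAt_weyl (hS : S.IsRegularOn U) (hU : IsOpen U) (hx : x ∈ U)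
    (a b c d : Fin 4) : ContDiffAt ℝ ∞ (S.weyl a b c d) x := by
  have hE := contDiffAt_extMat fun α β => (hS.smooth_E α β).contDiffAt (hU.mem_nhds hx)
  have hH := contDiffAt_extMat fun α β => (hS.smooth_H α β).contDiffAt (hU.mem_nhds hx)
  unfold weyl
  fun_prop

theorem IsRegularOn.contDiffAt_T (hS : S.IsRegularOn U) (hU : IsOpen U) (hx : x ∈ U)
    (a b : Fin 4) : ContDiffAt ℝ ∞ (S.T a b) x := by
  have haniso := contDiffAt_extMat fun α β => (hS.smooth_aniso α β).contDiffAt (hU.mem_nhds hx)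
  have hq := contDiffAt_extVec fun α => (hS.smooth_q α).contDiffAt (hU.mem_nhds hx)
  have hρ := hS.smooth_ρ.contDiffAt (hU.mem_nhds hx)
  have hp := hS.smooth_p.contDiffAt (hU.mem_nhds hx)
  unfold T
  fun_prop

theorem IsRegularOn.contDiffAt_KUp (hS : S.IsRegularOn U) (hU : IsOpen U) (hx : x ∈ U)
    (a b c d : Fin 4) : ContDiffAt ℝ ∞ (S.KUp a b c d) x := by
  have hweyl := hS.contDiffAt_weyl hU hx
  have hT := hS.contDiffAt_T hU hx
  unfold KUp K ric trT
  fun_prop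

end Smoothness

section MatrixValued

open scoped Matrix.Norms.Operator

attribute [local instance] LieRing.ofAssociativeRing

variable {m n : Type*} [Fintype m] [Fintype n] {M : Pt → Matrix m n ℝ}

theorem contDiffAt_matrix (hM : ∀ i j, ContDiffAt ℝ ∞ (fun y => M y i j) x) :
    ContDiffAt ℝ ∞ M x := by
  classical
  have hsum : M = fun y => ∑ i, ∑ j, M y i j • Matrix.single i j (1 : ℝ) := by
    funext y
    simpa using Matrix.matrix_eq_sum_single (M y)
  rw [hsum]
  fun_prop

theorem frameDeriv_matrix_apply (a : Fin 4) (hM : DifferentiableAt ℝ M x) (i : m) (j : n) :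
    S.frameDeriv a M x i j = S.dd a (fun y => M y i j) x := by
  let entry : Matrix m n ℝ →L[ℝ] ℝ := (Matrix.entryLinearMap ℝ ℝ i j).toContinuousLinearMap
  exact (DFunLike.congr_fun (entry.hasFDerivAt.comp x hM.hasFDerivAt).fderiv (S.e a x)).symm

variable (S) in
/-- The connection form of `∇` in the tetrad, as a matrix-valued 1-form. -/
def ΓMat (c : Fin 4) (y : Pt) : Matrix (Fin 4) (Fin 4) ℝ := Matrix.of fun a b => S.Γ a b c y

variable (S) in
/-- The curvature variable, as a matrix-valued 2-form. -/
def KMat (c d : Fin 4) (y : Pt) : Matrix (Fin 4) (Fin 4) ℝ :=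
  raiseMatrix (fun a b c d => S.K a b c d y) c d

theorem KMat_apply (a b c d : Fin 4) (y : Pt) : S.KMat c d y a b = S.KUp a b c d y :=
  (sum_g_mul a fun f => S.K f b c d y).symm

theorem KMat_antisymm (c d : Fin 4) (y : Pt) : S.KMat c d y = -S.KMat d c y := by
  ext a b
  simp only [KMat, raiseMatrix, Matrix.of_apply, Matrix.neg_apply]
  rw [K_antisymm, mul_neg]

theorem IsRegularOn.contDiffAt_ΓMat (hS : S.IsRegularOn U) (hU : IsOpen U) (hx : x ∈ U)
    (c : Fin 4) : ContDiffAt ℝ ∞ (S.ΓMat c) x :=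
  contDiffAt_matrix fun a b => hS.contDiffAt_Γ hU hx a b c

theorem IsRegularOn.contDiffAt_KMat (hS : S.IsRegularOn U) (hU : IsOpen U) (hx : x ∈ U)
    (c d : Fin 4) : ContDiffAt ℝ ∞ (S.KMat c d) x :=
  contDiffAt_matrix fun a b => by
    simpa only [KMat_apply] using hS.contDiffAt_KUp hU hx a b c d

theorem IsRegularOn.curvature_ΓMat (hS : S.IsRegularOn U) (hU : IsOpen U) (hx : x ∈ U)
    (c d : Fin 4) : S.curvature S.ΓMat c d x = raiseMatrix (S.riemannLow x) c d := by
  have hΓ (c : Fin 4) : DifferentiableAt ℝ (S.ΓMat c) x :=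
    (hS.contDiffAt_ΓMat hU hx c).differentiableAt (by simp)
  ext a b
  simp only [curvature, Ring.lie_def, Matrix.sub_apply, Matrix.add_apply, Matrix.mul_apply,
    Matrix.sum_apply, Matrix.smul_apply, smul_eq_mul, frameDeriv_matrix_apply _ (hΓ _),
    raiseMatrix, riemannLow, Matrix.of_apply, riemann, Finset.sum_sub_distrib, ← mul_assoc,
    g_mul_self, one_mul, ΓMat]
  simp only [mul_comm]
  ring

theorem IsRegularOn.extCovD_KMat_apply (hS : S.IsRegularOn U) (hU : IsOpen U) (hx : x ∈ U)
    (a b c d e : Fin 4) : S.extCovD S.ΓMat S.KMat c d e x a b =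
      S.covK a b c d e x + S.covK a b d e c x + S.covK a b e c d x := by
  have hK (c d : Fin 4) : DifferentiableAt ℝ (S.KMat c d) x :=
    (hS.contDiffAt_KMat hU hx c d).differentiableAt (by simp)
  have hanti (f c : Fin 4) : S.KUp a b f c x = -S.KUp a b c f x := by
    simpa only [KMat_apply, Matrix.neg_apply] using congrFun₂ (KMat_antisymm (S := S) f c x) a b
  have hcovK (c d e : Fin 4) : S.covK a b c d e x = S.covD S.ΓMat e (S.KMat c d) x a b
      + ∑ f, S.Γ f c e x * S.KUp a b d f x - ∑ f, S.Γ f d e x * S.KUp a b c f x := by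
    simp only [covK, covD, Ring.lie_def, Matrix.sub_apply, Matrix.add_apply, Matrix.mul_apply,
      frameDeriv_matrix_apply _ (hK _ _), KMat_apply, ΓMat, Matrix.of_apply,
      Finset.sum_sub_distrib, hanti _ d, mul_neg, Finset.sum_neg_distrib]
    simp only [mul_comm]
    ring
  have hγ (c d e : Fin 4) : ∑ f, S.γ f c d x * S.KUp a b f e x
      = ∑ f, S.Γ f c d x * S.KUp a b e f x - ∑ f, S.Γ f d c x * S.KUp a b e f x := by
    simp only [← hS.Γ_sub_Γ hx, hanti _ e, ← Finset.sum_sub_distrib]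
    exact Finset.sum_congr rfl fun f _ => by ring
  simp only [extCovD, Matrix.sub_apply, Matrix.add_apply, Matrix.sum_apply, Matrix.smul_apply,
    smul_eq_mul, KMat_apply, hγ, hcovK]
  ring

end MatrixValued

section Deviation

variable (S) in
/-- The deviation `K_abcd - R_abcd` of the curvature variable from the curvature. -/
def deviation (x : Pt) (a b c d : Fin 4) : ℝ := S.K a b c d x - S.riemannLow x a b c d

theorem IsRegularOn.isCurvatureLike_deviation (hS : S.IsRegularOn U) (hU : IsOpen U)
    (hx : x ∈ U) (hJ : S.Jacobi x) : IsCurvatureLike (S.deviation x) :=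
  (hS.isCurvatureLike_K hx).sub (hS.isCurvatureLike_riemannLow hU hx hJ)

theorem IsRegularOn.deviation_zero (hS : S.IsRegularOn U) (hU : IsOpen U) (hx : x ∈ U)
    (hJ : S.Jacobi x) (hR : S.RicciU x) (a b d : Fin 4) : S.deviation x a b 0 d = 0 := by
  have hΔ := hS.isCurvatureLike_deviation hU hx hJ
  rw [hΔ.pair_symm, hΔ.antisymm_left, deviation, riemannLow, hS.riemann_zero hx hR, KUp,
    sum_g_mul, ← mul_assoc, g_mul_self, one_mul, sub_self, neg_zero]

theorem ricciContraction_riemannLow (x : Pt) (b d : Fin 4) :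
    ricciContraction (S.riemannLow x) b d = S.ricci b d x := by
  simp only [ricciContraction, riemannLow, ← mul_assoc, g_mul_self, one_mul, ricci]

theorem einsteinContraction_riemannLow (x : Pt) (a b : Fin 4) :
    einsteinContraction (S.riemannLow x) a b = S.einstein a b x := by
  simp only [einsteinContraction, ricciContraction_riemannLow, einstein, scalar, sum_g_mul]

theorem IsRegularOn.einsteinContraction_deviation (hS : S.IsRegularOn U) (hx : x ∈ U)
    (a b : Fin 4) :
    einsteinContraction (S.deviation x) a b = S.T a b x - S.einstein a b x := by
  rw [← hS.einsteinContraction_K hx, ← einsteinContraction_riemannLow,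
    ← einsteinContraction_sub]
  rfl

theorem IsRegularOn.Y_apply (hS : S.IsRegularOn U) (hx : x ∈ U) (α β : Fin 3) :
    S.Y x α β = einsteinContraction (S.deviation x) α.succ β.succ :=
  (hS.einsteinContraction_deviation hx _ _).symm

theorem IsRegularOn.isSymm_Y (hS : S.IsRegularOn U) (hU : IsOpen U) (hx : x ∈ U)
    (hJ : S.Jacobi x) : (S.Y x).IsSymm := by
  ext α β
  rw [Matrix.transpose_apply, hS.Y_apply hx, hS.Y_apply hx,
    (hS.isCurvatureLike_deviation hU hx hJ).einsteinContraction_comm]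

theorem IsRegularOn.efe_iff_Y_eq_zero (hS : S.IsRegularOn U) (hU : IsOpen U) (hx : x ∈ U)
    (hJ : S.Jacobi x) (hR : S.RicciU x) : S.EFE x ↔ S.Y x = 0 := by
  have hspatial := (hS.isCurvatureLike_deviation hU hx hJ).einsteinContraction_eq_zero_iff
    (hS.deviation_zero hU hx hJ hR)
  simp only [hS.einsteinContraction_deviation hx, sub_eq_zero] at hspatial
  simp only [EFE, eq_comm (b := S.T _ _ x), hspatial, ← Matrix.ext_iff, Y, Matrix.of_apply,
    Matrix.zero_apply, sub_eq_zero]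

theorem IsRegularOn.raiseMatrix_deviation_zero (hS : S.IsRegularOn U) (hU : IsOpen U)
    (hx : x ∈ U) (hJ : S.Jacobi x) (hR : S.RicciU x) (d : Fin 4) :
    raiseMatrix (S.deviation x) 0 d = 0 := by
  ext a b
  simp [raiseMatrix, hS.deviation_zero hU hx hJ hR]

theorem IsRegularOn.raiseMatrix_deviation_succ (hS : S.IsRegularOn U) (hU : IsOpen U)
    (hx : x ∈ U) (hJ : S.Jacobi x) (hR : S.RicciU x) (α : Fin 3) :
    raiseMatrix (S.deviation x) (α + 1).succ (α + 2).succ = lorentzGen (0, S.Y x α) := by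
  have hΔ := hS.isCurvatureLike_deviation hU hx hJ
  have hΔ₀ := hS.deviation_zero hU hx hJ hR
  rw [hΔ.raiseMatrix_eq_lorentzGen]
  congr 1
  ext β
  · simp [hΔ.pair_symm 0, hΔ₀]
  · simp [hΔ.dual_dual hΔ₀, hS.Y_apply hx, hΔ.einsteinContraction_comm β.succ]

theorem IsRegularOn.KMat_zero_succ (hS : S.IsRegularOn U) (hx : x ∈ U) (α : Fin 3) :
    S.KMat 0 α.succ x = lorentzGen
      (-(S.I x + ((S.ρ x + 3 * S.p x) / 6) • (1 : Matrix (Fin 3) (Fin 3) ℝ))ᵀ α,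
        (S.J x)ᵀ α) := by
  rw [KMat, (hS.isCurvatureLike_K hx).raiseMatrix_eq_lorentzGen]
  simp only [hS.K_electric hx, hS.K_magnetic hx, neg_neg]
  rfl

attribute [local instance] LieRing.ofAssociativeRing

open scoped Matrix.Norms.Operator in
theorem IsRegularOn.sum_lie_deviation (hS : S.IsRegularOn U) (hU : IsOpen U) (hx : x ∈ U)
    (hJ : S.Jacobi x) (hR : S.RicciU x) (hB : ∀ y ∈ U, S.Bianchi y) :
    ∑ α : Fin 3, ⁅raiseMatrix (S.deviation x) (α + 1).succ (α + 2).succ, S.KMat 0 α.succ x⁆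
      = 0 := by
  have hclosed : ∀ y ∈ U, ∀ c d e, S.extCovD S.ΓMat S.KMat c d e y = 0 := fun y hy c d e => by
    ext a b
    rw [hS.extCovD_KMat_apply hU hy]
    exact hB y hy a b c d e
  have hcurv (c d : Fin 4) : S.curvature S.ΓMat c d x
      = S.KMat c d x - raiseMatrix (S.deviation x) c d := by
    rw [hS.curvature_ΓMat hU hx, KMat, ← raiseMatrix_sub]
    simp only [deviation, sub_sub_cancel]
  have hcomm := hS.sum_lie_curvature_eq_zero hU hx hJ (hS.contDiffAt_ΓMat hU hx)
    (hS.contDiffAt_KMat hU hx) KMat_antisymm hclosed 0 1 2 3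
  simp only [hcurv, hS.raiseMatrix_deviation_zero hU hx hJ hR, sub_zero, sub_lie] at hcomm
  rw [← lie_skew (S.KMat 2 3 x), ← lie_skew (S.KMat 3 1 x), ← lie_skew (S.KMat 1 2 x)] at hcomm
  rw [← neg_eq_zero, ← hcomm, Fin.sum_univ_three]
  change -(⁅raiseMatrix (S.deviation x) 2 3, S.KMat 0 1 x⁆
    + ⁅raiseMatrix (S.deviation x) 3 1, S.KMat 0 2 x⁆
    + ⁅raiseMatrix (S.deviation x) 1 2, S.KMat 0 3 x⁆) = _
  abel

end Deviation

section LinearSystem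

theorem IsRegularOn.isSymm_I (hS : S.IsRegularOn U) (hx : x ∈ U) : (S.I x).IsSymm :=
  (hS.symm_E x hx).sub ((hS.symm_aniso x hx).smul _)

theorem ySystem_iff (hI : (S.I x).IsSymm) (hY : (S.Y x).IsSymm) :
    S.YSystem x ↔ (S.I x * S.Y x).IsSymm ∧ (S.J x * S.Y x).IsSymm := by
  have hIs := hI.apply
  have hYs := hY.apply
  simp only [isSymm_fin_three_iff, Matrix.mul_apply, Fin.sum_univ_three, YSystem, funext_iff,
    Fin.forall_fin_succ, IsEmpty.forall_iff, and_true]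
  simp only [Matrix.mulVec, dotProduct, Matrix.of_apply, Matrix.cons_val', Matrix.cons_val,
    Matrix.cons_val_fin_one, Matrix.cons_val_zero, Matrix.cons_val_one, Fin.sum_univ_three,
    Fin.succ_zero_eq_one, Fin.succ_one_eq_two, hIs 0 1, hIs 1 2, hIs 2 0, hYs 0 1, hYs 1 2, hYs 2 0]
  refine and_congr ?_ ?_ <;> constructor <;> rintro ⟨h₁, h₂, h₃⟩ <;> refine ⟨?_, ?_, ?_⟩ <;>
    linarith

theorem IsRegularOn.ySystem (hS : S.IsRegularOn U) (hU : IsOpen U) (hx : x ∈ U)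
    (hJ : S.Jacobi x) (hR : S.RicciU x) (hB : ∀ y ∈ U, S.Bianchi y) : S.YSystem x := by
  have hY := hS.isSymm_Y hU hx hJ
  have hI := hS.isSymm_I hx
  have hsum := hS.sum_lie_deviation hU hx hJ hR hB
  simp only [hS.raiseMatrix_deviation_succ hU hx hJ hR, hS.KMat_zero_succ hx, lie_lorentzGen,
    ← map_sum] at hsum
  have hzero := lorentzGen_injective (hsum.trans (map_zero _).symm)
  simp only [Prod.ext_iff, Prod.fst_sum, Prod.snd_sum] at hzero
  obtain ⟨hboost, hrot⟩ := hzero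
  simp only [map_zero, LinearMap.zero_apply, map_neg, cross_anticomm, zero_add, neg_zero,
    sub_zero, Prod.fst_zero, Prod.snd_zero] at hboost hrot
  rw [sum_cross_eq_zero_iff] at hboost hrot
  refine (ySystem_iff hI hY).mpr ⟨?_, ?_⟩
  · have hIY := hboost.sub (hY.smul ((S.ρ x + 3 * S.p x) / 6))
    simpa only [Matrix.transpose_transpose, add_mul, Matrix.smul_mul, one_mul,
      add_sub_cancel_right] using hIY
  · rwa [← Matrix.transpose_mul, Matrix.isSymm_transpose_iff] at hrot

theorem IsRegularOn.Y_eq_zero (hS : S.IsRegularOn U) (hx : x ∈ U) (hG : Generic S x)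
    (hY : (S.Y x).IsSymm) (hIY : (S.I x * S.Y x).IsSymm) (hJY : (S.J x * S.Y x).IsSymm) :
    S.Y x = 0 := by
  have hI := hS.isSymm_I hx
  have hH := hS.symm_H x hx
  have hIYcomm : Commute (S.I x) (S.Y x) := by
    rw [Commute, SemiconjBy, ← hIY.eq, Matrix.transpose_mul, hI.eq, hY.eq]
  have hYH := hG.nonDegenerate.commute hI hIYcomm hG.commute
  refine hG.nonDegenerate.eq_zero_of_trace_smul_sub_mulVec hI hG.commute hIYcomm
    hG.not_parallel (crossMatrix_injective ?_)
  rw [← transpose_mul_crossMatrix_add]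
  have hJYt := hJY.eq
  simp only [J_eq, Matrix.transpose_mul, Matrix.transpose_add, Matrix.transpose_smul] at hJYt
  rw [hY.eq, hH.eq, transpose_crossMatrix, mul_add, add_mul, hYH.eq, Matrix.mul_smul,
    Matrix.smul_mul, add_right_inj] at hJYt
  have hcross := smul_right_injective _ (one_half_pos (α := ℝ)).ne' hJYt
  rw [hY.eq, crossMatrix_zero, ← hcross, mul_neg, add_neg_cancel]

theorem IsRegularOn.ySystem_iff_efe (hS : S.IsRegularOn U) (hU : IsOpen U) (hx : x ∈ U)
    (hJ : S.Jacobi x) (hR : S.RicciU x) (hG : Generic S x) : S.YSystem x ↔ S.EFE x := by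
  have hY := hS.isSymm_Y hU hx hJ
  rw [hS.efe_iff_Y_eq_zero hU hx hJ hR, ySystem_iff (hS.isSymm_I hx) hY]
  refine ⟨fun ⟨hIY, hJY⟩ => hS.Y_eq_zero hx hG hY hIY hJY, fun hY₀ => ?_⟩
  simp only [hY₀, mul_zero, Matrix.isSymm_zero, and_self]

end LinearSystem

end Fields

end JRB

end

theorem theorem2 (U : Set JRB.Pt) (hU : IsOpen U) (S : JRB.Fields) (hS : S.IsRegularOn U) :
    -- for a generic solution of the JRB-system the field equations hold
    (S.IsJRBSolutionOn U → ∀ x ∈ U, JRB.Generic S x → S.EFE x) ∧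
    -- the integrability conditions of the Bianchi equations: a linear system for the `𝓨_αβ`
    (S.IsJRBSolutionOn U → ∀ x ∈ U, S.YSystem x) ∧
    -- in the generic case these conditions are nothing but the field equations
    (∀ x ∈ U, S.Jacobi x → S.RicciU x → JRB.Generic S x → (S.YSystem x ↔ S.EFE x)) := by
  have hY : S.IsJRBSolutionOn U → ∀ x ∈ U, S.YSystem x := fun hsol x hx =>
    hS.ySystem hU hx (hsol x hx).1 (hsol x hx).2.1 fun y hy => (hsol y hy).2.2
  have hiff : ∀ x ∈ U, S.Jacobi x → S.RicciU x → JRB.Generic S x → (S.YSystem x ↔ S.EFE x) :=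
    fun x hx hJ hR hG => hS.ySystem_iff_efe hU hx hJ hR hG
  exact ⟨fun hsol x hx hG => (hiff x hx (hsol x hx).1 (hsol x hx).2.1 hG).mp (hY hsol x hx), hY,
    hiff⟩
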